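/- **Conventions.** A reflexive digraph cycle $C=c_0c_1\cdots c_{m-1}c_0$ ($m\ge 3$) has vertices $c_0,\dots,c_{m-1}$, a loop at every vertex, and two distinct vertices are joined by an arc in at least one direction exactly when they are cyclically consecutive; the edge $c_{i-1}c_i$ is forward ($+$), backward ($-$) or symmetric ($*$), and $C$ is represented by its orientation string $x_1\cdots x_m\in\{+,-,*\}^m$. It is symmetric if all letters are $*$, and directed if all letters are $+$ or all letters are $-$. The cycle $D=(0)(1)\cdots(n-1)(0)$ has the integers modulo $n$ as vertices; it is non-contractible if $n\ge 4$ or $D$ is a directed $3$-cycle. $\sqrt D=y_1\cdots y_s$ is the shortest string with $\sqrt D^{\,r}=D$ for some integer $r$. For a string $Z$, $\sigma^i(Z)$ is its $i$-th cyclic shift, and indices of $y_j$ are read modulo $s$. For strings, $Z\le^* X$ means that there is a strictly increasing selection of letters of $X$ from which $Z$ is obtained by possibly changing letters to $*$. $\mathrm{Hom}(C,D)$ is the digraph of homomorphisms $C\to D$ with $\phi\to\phi'$ if $u\to v$ in $C$ implies $\phi(u)\to\phi'(v)$ in $D$. The wind of $\phi$ is $\frac1n$ times the number of $i$ with $\phi(c_{i+1})-\phi(c_i)=1$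 minus the number with $\phi(c_{i+1})-\phi(c_i)=-1$, and $\mathrm{Hom}_w(C,D)$ is the subgraph induced by the maps of wind $w$. Components are those of the underlying graph. An up edge is an edge $\phi\phi'$, in either direction and with $\phi\ne\phi'$, such that every vertex $c$ with $\phi'(c)\neq\phi(c)$ has $\phi'(c)=\phi(c)+1$. A component is cyclic if for any two maps $\phi,\phi'$ in it, possibly equal, there is a path of at least one up edge from $\phi$ to $\phi'$. **Theorem.** Let $C$ and $D=\sqrt D^{\,r}=(y_1\cdots y_s)^r$ be reflexive digraph cycles of lengths $m$ and $n=rs$ such that $D$ is non-contractible. Let $R$ be the maximum integer such that $\sigma^i(\sqrt D^{\,R})\le^* C$ for some $i$. Except in the exceptional case that $D$ is a symmetric cycle and $C$ is a directed cycle, the subgraph $\mathrm{Hom}_w(C,D)$, for an integer $w\ge 0$, consists of 1. a single cyclic component containing an (induced) copy of $D$ if $w=0$; 2. a single cyclic component if $0<w<R/r$, or if $0<w=R/r$ and $\sigma^i(\sqrt D)^{wr}y_{i+1}\le^* C$ for all shifts $\sigma^i$ of $\sqrt D$, $0\le i<s$; 3. $c$ components, none of them cyclic, if $0<w=R/r$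 and $\sigma^i(\sqrt D)^{wr}y_{i+1}\not\le^* C$ for some $i$, where $c$ is the number of $i\in\{0,\dots,n-1\}$ for which $\sigma^i(\sqrt D)^{wr}\le^* C$ but $\sigma^i(\sqrt D)^{wr}y_{i+1}\not\le^* C$; and is empty if $w>R/r$. In the exceptional case the same holds with (2) and (3) replaced by: a single cyclic component if $0<w\le R/r$. -/

import Mathlib

namespace CycleRecon

/-- A reflexive digraph cycle `(0)(1)⋯(n-1)(0)` on the integers modulo `n`: the length is at
least 3, every vertex has a loop, and two distinct vertices are joined by an edge (an arc in at
least one direction) exactly when they are consecutive modulo `n`. The base-point is `0` and the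
underlying orientation is the direction of increase. -/
structure IsReflexiveCycle {n : ℕ} (G : Digraph (ZMod n)) : Prop where
  three_le : 3 ≤ n
  loop : ∀ i, G.Adj i i
  edge_iff : ∀ i j, i ≠ j → ((G.Adj i j ∨ G.Adj j i) ↔ (j = i + 1 ∨ i = j + 1))

/-- The alphabet `{+, -, *}` of orientation strings: forward, backward, symmetric. -/
inductive Letter : Type
  | fwd : Letter
  | bwd : Letter
  | sym : Letter

open Classical in
/-- The orientation of the edge between `i` and `i + 1` of a cycle `G`. -/
noncomputable def edgeLetter {n : ℕ} (G : Digraph (ZMod n)) (i : ZMod n) : Letter :=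
  if G.Adj i (i + 1) then
    if G.Adj (i + 1) i then Letter.sym else Letter.fwd
  else Letter.bwd

/-- The orientation string of a cycle with base-point `0`. -/
noncomputable def orientationString {n : ℕ} (G : Digraph (ZMod n)) : List Letter :=
  (List.range n).map fun i => edgeLetter G (i : ZMod n)

/-- A cycle is symmetric if all its edges are symmetric. -/
def IsSymmetricCycle {n : ℕ} (G : Digraph (ZMod n)) : Prop :=
  ∀ i, edgeLetter G i = Letter.sym

/-- A cycle is directed if all its edges are forward or all its edges are backward. -/
def IsDirectedCycle {n : ℕ} (G : Digraph (ZMod n)) : Prop :=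
  (∀ i, edgeLetter G i = Letter.fwd) ∨ (∀ i, edgeLetter G i = Letter.bwd)

/-- A reflexive digraph cycle is non-contractible if it has length at least 4 or is a directed
3-cycle. -/
def NonContractible {n : ℕ} (G : Digraph (ZMod n)) : Prop :=
  4 ≤ n ∨ (n = 3 ∧ IsDirectedCycle G)

/-- `StarSub D C` is `D ≤* C`: there is a strictly increasing selection function `α` such that
`D` arises from the letters of `C` selected by `α` by possibly changing letters to `*`. -/
def StarSub (D C : List Letter) : Prop :=
  ∃ α : Fin D.length → Fin C.length, StrictMono α ∧
    ∀ j, D.get j = Letter.sym ∨ D.get j = C.get (α j)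

/-- The concatenation of `k` copies of a string. The `i`-th shift of a string `Y` is Mathlib's
`Y.rotate i`. -/
def power (Y : List Letter) (k : ℕ) : List Letter :=
  (List.replicate k Y).flatten

/-- `Y` is the primitive root of the string `D` and `D = Y ^ r`: it is a shortest string some
power of which is `D`. -/
def IsRoot (Y : List Letter) (r : ℕ) (D : List Letter) : Prop :=
  power Y r = D ∧ ∀ (Z : List Letter) (k : ℕ), power Z k = D → Y.length ≤ Z.length

/-- The string `σ^i(Y)^k y_{i+1}`: `k` copies of the `i`-th shift of `Y`, followed by the letter
`y_{i+1}` of `Y` (index modulo the length of `Y`), which is the first letter of `σ^i(Y)`. -/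
def extendedPower (Y : List Letter) (i k : ℕ) : List Letter :=
  power (Y.rotate i) k ++ (Y.rotate i).take 1

/-- Homomorphisms of digraphs: maps that preserve arcs. -/
abbrev DHom {V W : Type*} (G : Digraph V) (H : Digraph W) : Type _ := G.Adj →r H.Adj

/-- The digraph `Hom(G, H)`. -/
def homGraph {V W : Type*} (G : Digraph V) (H : Digraph W) : Digraph (DHom G H) where
  Adj φ ψ := ∀ u v, G.Adj u v → H.Adj (φ u) (ψ v)

/-- The contribution of an edge to the increase of a homomorphism to a cycle of length `n`, as a
function of the difference of the images of its ends: increasing `1`, decreasing `-1`,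
stationary `0`. -/
def edgeIncrease {n : ℕ} (d : ZMod n) : ℤ :=
  if d = 1 then 1 else if d = -1 then -1 else 0

/-- The increase of a homomorphism of cycles: the number of increasing edges minus the number of
decreasing edges. -/
def increase {m n : ℕ} {C : Digraph (ZMod m)} {D : Digraph (ZMod n)} (φ : DHom C D) : ℤ :=
  ∑ i ∈ Finset.range m, edgeIncrease (φ ((i : ZMod m) + 1) - φ (i : ZMod m))

/-- The wind of a homomorphism of cycles: its increase divided by the length of the target. -/
def wind {m n : ℕ} {C : Digraph (ZMod m)} {D : Digraph (ZMod n)} (φ : DHom C D) : ℚ :=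
  (increase φ : ℚ) / (n : ℚ)

/-- The homomorphisms of wind `w`. -/
abbrev WindHom {m n : ℕ} (C : Digraph (ZMod m)) (D : Digraph (ZMod n)) (w : ℕ) : Type :=
  {φ : DHom C D // wind φ = (w : ℚ)}

/-- The subgraph `Hom_w(C, D)` of `Hom(C, D)` induced by the maps of wind `w`. -/
def windGraph {m n : ℕ} (C : Digraph (ZMod m)) (D : Digraph (ZMod n)) (w : ℕ) :
    Digraph (WindHom C D w) where
  Adj φ ψ := (homGraph C D).Adj φ.1 ψ.1

/-- The components of `Hom_w(C, D)`, that is, those of its underlying graph. -/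
abbrev WindComponent {m n : ℕ} (C : Digraph (ZMod m)) (D : Digraph (ZMod n)) (w : ℕ) : Type :=
  (windGraph C D w).toSimpleGraphInclusive.ConnectedComponent

/-- A (non-loop) up edge of `Hom_w(C, D)`: an edge, in either direction, between two distinct
maps such that every vertex that moves is moved up by one. -/
def UpEdge {m n : ℕ} {C : Digraph (ZMod m)} {D : Digraph (ZMod n)} {w : ℕ}
    (φ ψ : WindHom C D w) : Prop :=
  φ ≠ ψ ∧ ((windGraph C D w).Adj φ ψ ∨ (windGraph C D w).Adj ψ φ) ∧
    ∀ v, ψ.1 v ≠ φ.1 v → ψ.1 v = φ.1 v + 1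

/-- A component is cyclic if for any two maps `φ` and `ψ` in it (possibly equal) there is a
non-trivial path of up edges from `φ` to `ψ`. -/
def IsCyclicComponent {m n : ℕ} {C : Digraph (ZMod m)} {D : Digraph (ZMod n)} {w : ℕ}
    (K : WindComponent C D w) : Prop :=
  ∀ φ ψ : WindHom C D w, φ ∈ K.supp → ψ ∈ K.supp → Relation.TransGen UpEdge φ ψ

/-- `Hom_w(C, D)` consists of a single cyclic component. -/
def IsSingleCyclic {m n : ℕ} (C : Digraph (ZMod m)) (D : Digraph (ZMod n)) (w : ℕ) : Prop :=
  ∃ K : WindComponent C D w, (∀ K' : WindComponent C D w, K' = K) ∧ IsCyclicComponent K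

end CycleRecon

open CycleRecon

/-!
The proof lifts everything to the integers. A map `C → D` of wind `w` lifts to `f : ℤ → ℤ` with
`f (i + m) = f i + n * w`, uniquely up to adding multiples of `n`, and because a transitive triangle
cannot wind around a non-contractible `D`, arcs of `Hom(C, D)` lift as well (`liftAdj_of_adj`).
Every such arc from `f` to `g` splits into the upward moves from `f` and from `g` to `max f g`
(`LiftAdj.sup`), so components are governed by upward moves.

Suppose `f ≤ g` are distinct lifts. Raising a vertex `u` where `f u < g u` may force a neighbour to
be raised too, but only one that is not higher and at which `f` is again below `g`. So forcing either
stops, and then a whole level interval of `f` can be raised without passing `g`, or it runs all the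
way around `C`. For `w = 0` the latter means that `f` is constant, and then all of `f` can be raised.
For `w > 0` it means that `f` is *locked*: it is the greedy walk, which advances in `D` whenever the
next letter of `C` permits (`exists_liftUp_or_locked`). If no locked lift exists, or in the
exceptional case, where a locked lift can be raised as a whole, any lift can be raised to any lift
above it, hence `Hom_w(C, D)` is a single cyclic component (`isSingleCyclic_of_progress`). Otherwise a
locked lift is a barrier for upward moves (`Locked.barrier`), every map can be raised to one with a
locked lift, and the set of locked lifts above a lift is an invariant of its component. So the
components correspond to the locked maps and none of them is cyclic.

The string conditions describe greedy walks: if `F a` is the endpoint of the greedy walk around `C`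
from `a`, then `σ^i(√D)^k ≤* C` means `F i ≥ i + k * s` and `σ^i(√D)^k y_{i+1} ≤* C` means
`F i > i + k * s` (`starSub_iff_le_greedy`). A lift of wind `w` exists if and only if
`F a ≥ a + n * w` for some `a`, and the locked lifts correspond to the solutions of
`F a = a + n * w`. Since `F` is monotone and commutes with translation by `s`, there is no solution if
`F a ≥ a + n * w + s` for some `a`, and there is one if `F a ≥ a + n * w` and `F b ≤ b + n * w` for
some `a` and `b` (`exists_greedy_eq`).
-/

namespace CycleRecon

variable {m n : ℕ} {C : Digraph (ZMod m)} {D : Digraph (ZMod n)} {w : ℕ} {Y : List Letter} {r : ℕ}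

/-! ### Lifting cycles and homomorphisms to the integers -/

/-- The universal cover of a reflexive cycle on `ZMod n`: the reflexive digraph path on `ℤ` in
which `a` and `b` are joined only if they differ by at most one, oriented as their residues. -/
def lineAdj (G : Digraph (ZMod n)) (a b : ℤ) : Prop :=
  G.Adj (a : ZMod n) (b : ZMod n) ∧ a ≤ b + 1 ∧ b ≤ a + 1

theorem lineAdj_self (hD : IsReflexiveCycle D) (a : ℤ) : lineAdj D a a :=
  ⟨hD.loop _, by omega, by omega⟩

theorem IsReflexiveCycle.one_ne_zero (hD : IsReflexiveCycle D) : (1 : ZMod n) ≠ 0 := by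
  have h3 := hD.three_le
  have : Fact (1 < n) := ⟨by omega⟩
  exact _root_.one_ne_zero

theorem lineAdj_total (hD : IsReflexiveCycle D) (a : ℤ) :
    lineAdj D a (a + 1) ∨ lineAdj D (a + 1) a := by
  have h := (hD.edge_iff (a : ZMod n) ((a + 1 : ℤ) : ZMod n) (by
    push_cast
    intro h
    exact hD.one_ne_zero (by simpa using h))).2 (Or.inl (by push_cast; rfl))
  rcases h with h | h
  · exact Or.inl ⟨h, by omega, by omega⟩
  · exact Or.inr ⟨h, by omega, by omega⟩

theorem lineAdj_total' (hD : IsReflexiveCycle D) {a b : ℤ} (h1 : a ≤ b + 1) (h2 : b ≤ a + 1) :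
    lineAdj D a b ∨ lineAdj D b a := by
  rcases (by omega : b = a ∨ b = a + 1 ∨ a = b + 1) with rfl | rfl | rfl
  · exact Or.inl (lineAdj_self hD _)
  · exact lineAdj_total hD a
  · exact (lineAdj_total hD b).symm

theorem lineAdj_add_mul (G : Digraph (ZMod n)) (a b t : ℤ) :
    lineAdj G (a + n * t) (b + n * t) ↔ lineAdj G a b := by
  unfold lineAdj
  push_cast
  simp only [ZMod.natCast_self, zero_mul, add_zero]
  constructor <;> rintro ⟨h, h1, h2⟩ <;> exact ⟨h, by omega, by omega⟩

/-- `f` is a lift of a homomorphism `C → D` of wind `w`: a homomorphism of the universal covers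
that advances by `w` turns of `D` along one turn of `C`. -/
structure IsLift (C : Digraph (ZMod m)) (D : Digraph (ZMod n)) (w : ℕ) (f : ℤ → ℤ) : Prop where
  hom : ∀ i j, lineAdj C i j → lineAdj D (f i) (f j)
  period : ∀ i, f (i + m) = f i + n * w

theorem IsLift.period_mul {f : ℤ → ℤ} (hf : IsLift C D w f) (i t : ℤ) :
    f (i + m * t) = f i + n * (w * t) := by
  induction t using Int.induction_on with
  | zero => simp
  | succ t ih =>
    have := hf.period (i + m * t)
    rw [show i + m * ((t : ℤ) + 1) = i + m * t + m by ring, this, ih]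
    ring
  | pred t ih =>
    have := hf.period (i + m * (-(t : ℤ) - 1))
    rw [show i + m * (-(t : ℤ) - 1) + m = i + m * (-t) by ring, ih] at this
    linarith

theorem IsLift.step (hC : IsReflexiveCycle C) {f : ℤ → ℤ} (hf : IsLift C D w f) {i j : ℤ}
    (h1 : i ≤ j + 1) (h2 : j ≤ i + 1) : f i ≤ f j + 1 ∧ f j ≤ f i + 1 := by
  rcases lineAdj_total' hC h1 h2 with h | h
  · exact (hf.hom _ _ h).2
  · exact (hf.hom _ _ h).2.symm

theorem IsLift.of_step (hD : IsReflexiveCycle D) {f : ℤ → ℤ}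
    (hs : ∀ k, (lineAdj C k (k + 1) → lineAdj D (f k) (f (k + 1))) ∧
      (lineAdj C (k + 1) k → lineAdj D (f (k + 1)) (f k)))
    (hp : ∀ i, f (i + m) = f i + n * w) : IsLift C D w f := by
  refine ⟨fun i j h => ?_, hp⟩
  have := h.2
  rcases (by omega : j = i ∨ j = i + 1 ∨ i = j + 1) with rfl | rfl | rfl
  · exact lineAdj_self hD _
  · exact (hs i).1 h
  · exact (hs j).2 h

theorem IsLift.add_mul {f : ℤ → ℤ} (hf : IsLift C D w f) (t : ℤ) :
    IsLift C D w (fun i => f i + n * t) := by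
  refine ⟨fun i j h => (lineAdj_add_mul D _ _ _).2 (hf.hom i j h), fun i => ?_⟩
  have := hf.period i
  simp only [this]
  ring

/-- The arc relation of `Hom(C, D)` on lifts. -/
def LiftAdj (C : Digraph (ZMod m)) (D : Digraph (ZMod n)) (f g : ℤ → ℤ) : Prop :=
  ∀ i j, lineAdj C i j → lineAdj D (f i) (g j)

/-- An up edge between lifts: some vertices are raised by one, the others stay. -/
structure LiftUp (C : Digraph (ZMod m)) (D : Digraph (ZMod n)) (f g : ℤ → ℤ) : Prop where
  ne : f ≠ g
  adj : LiftAdj C D f g ∨ LiftAdj C D g f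
  raise : ∀ k, g k = f k ∨ g k = f k + 1

theorem LiftUp.le {f g : ℤ → ℤ} (h : LiftUp C D f g) : f ≤ g := fun k => by
  change f k ≤ g k
  rcases h.raise k with h | h <;> omega

/-- Every arc of `Hom(C, D)` splits into an upward and a downward move, through the pointwise
maximum of its ends. -/
theorem LiftAdj.sup (hC : IsReflexiveCycle C) (hD : IsReflexiveCycle D) {f g : ℤ → ℤ}
    (hf : IsLift C D w f) (hg : IsLift C D w g) (h : LiftAdj C D f g) :
    IsLift C D w (f ⊔ g) ∧ LiftAdj C D f (f ⊔ g) ∧ LiftAdj C D (f ⊔ g) g := by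
  have hd : ∀ i, f i ≤ g i + 1 ∧ g i ≤ f i + 1 := fun i => (h i i (lineAdj_self hC i)).2
  refine ⟨⟨fun i j hij => ?_, fun i => ?_⟩, fun i j hij => ?_, fun i j hij => ?_⟩
  · have h1 := hf.hom i j hij
    have h2 := hg.hom i j hij
    have h3 := h i j hij
    simp only [Pi.sup_apply]
    rcases le_total (f i) (g i) with hi | hi <;> rcases le_total (f j) (g j) with hj | hj <;>
      simp only [hi, hj, sup_of_le_left, sup_of_le_right]
    · exact h2
    · by_cases he : f j = g j
      · rwa [he]
      · by_cases he' : f i = g i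
        · rwa [← he']
        · have := h1.2
          have := h2.2
          have := hd i
          have := hd j
          rw [show g i = f j by omega]
          exact lineAdj_self hD _
    · exact h3
    · exact h1
  · simp only [Pi.sup_apply, hf.period, hg.period, max_add_add_right]
  · simp only [Pi.sup_apply]
    rcases le_total (f j) (g j) with hj | hj <;> simp only [hj, sup_of_le_left, sup_of_le_right]
    · exact h i j hij
    · exact hf.hom i j hij
  · simp only [Pi.sup_apply]
    rcases le_total (f i) (g i) with hj | hj <;> simp only [hj, sup_of_le_left, sup_of_le_right]
    · exact hg.hom i j hij
    · exact h i j hij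

/-! ### Raising a lift below another lift -/

/-- Raising `u` by one while the neighbour `v` stays keeps the edge between `u` and `v`. -/
def Loose (C : Digraph (ZMod m)) (D : Digraph (ZMod n)) (f : ℤ → ℤ) (u v : ℤ) : Prop :=
  (lineAdj C u v → lineAdj D (f u + 1) (f v)) ∧ (lineAdj C v u → lineAdj D (f v) (f u + 1))

/-- No vertex can be raised unless its predecessor is raised as well. Equivalently, along `C` the
lift `f` advances whenever the next edge of `C` can be mapped forward. -/
def Locked (C : Digraph (ZMod m)) (D : Digraph (ZMod n)) (f : ℤ → ℤ) : Prop :=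
  ∀ k, ¬ Loose C D f k (k - 1)

theorem loose_add_mul {f : ℤ → ℤ} (hf : IsLift C D w f) (u v t : ℤ) :
    Loose C D f (u + m * t) (v + m * t) ↔ Loose C D f u v := by
  unfold Loose
  rw [lineAdj_add_mul, lineAdj_add_mul, hf.period_mul, hf.period_mul,
    show f u + n * (w * t) + 1 = f u + 1 + n * (w * t) by ring, lineAdj_add_mul, lineAdj_add_mul]

theorem le_of_loose (hC : IsReflexiveCycle C) {f : ℤ → ℤ} {u v : ℤ} (h1 : u ≤ v + 1)
    (h2 : v ≤ u + 1) (h : Loose C D f u v) : f u ≤ f v := by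
  rcases lineAdj_total' hC h1 h2 with h' | h'
  · have := (h.1 h').2
    omega
  · have := (h.2 h').2
    omega

theorem le_of_not_loose (hC : IsReflexiveCycle C) (hD : IsReflexiveCycle D) {f : ℤ → ℤ}
    (hf : IsLift C D w f) {u v : ℤ} (h1 : u ≤ v + 1) (h2 : v ≤ u + 1)
    (h : ¬ Loose C D f u v) : f v ≤ f u := by
  by_contra hlt
  have := hf.step hC h1 h2
  have he : f v = f u + 1 := by omega
  exact h ⟨fun _ => he ▸ lineAdj_self hD _, fun _ => he ▸ lineAdj_self hD _⟩

theorem lt_of_not_loose (hC : IsReflexiveCycle C) (hD : IsReflexiveCycle D) {f g : ℤ → ℤ}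
    (hf : IsLift C D w f) (hg : IsLift C D w g) (hfg : f ≤ g) {u v : ℤ} (h1 : u ≤ v + 1)
    (h2 : v ≤ u + 1) (hu : f u < g u) (h : ¬ Loose C D f u v) : f v < g v := by
  by_contra hlt
  have hle : f v ≤ g v := hfg v
  have he : g v = f v := by omega
  have h3 := le_of_not_loose hC hD hf h1 h2 h
  have h4 := hg.step hC h1 h2
  have he' : g u = f u + 1 := by omega
  refine h ⟨fun h' => ?_, fun h' => ?_⟩
  · have := hg.hom _ _ h'
    rwa [he, he'] at this
  · have := hg.hom _ _ h'
    rwa [he, he'] at this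

theorem exists_last_of_periodic {P : ℤ → Prop} {d : ℤ} (hd : 0 < d)
    (hP : ∀ k t, P (k + d * t) ↔ P k) {k₀ : ℤ} (h₀ : P k₀) (i : ℤ) :
    ∃ l ≤ i, P l ∧ ∀ k, l < k → k ≤ i → ¬ P k := by
  classical
  obtain ⟨l, hl, hmax⟩ := Int.exists_greatest_of_bdd (P := fun l => l ≤ i ∧ P l) ⟨i, fun z h => h.1⟩
    ⟨k₀ + d * (-(|k₀ - i|)), by nlinarith [le_abs_self (k₀ - i), abs_nonneg (k₀ - i)],
      (hP _ _).2 h₀⟩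
  exact ⟨l, hl.1, hl.2, fun k h1 h2 hk => absurd (hmax k ⟨h2, hk⟩) (by omega)⟩

theorem exists_first_of_periodic {P : ℤ → Prop} {d : ℤ} (hd : 0 < d)
    (hP : ∀ k t, P (k + d * t) ↔ P k) {k₀ : ℤ} (h₀ : P k₀) (i : ℤ) :
    ∃ r ≥ i, P r ∧ ∀ k, i ≤ k → k < r → ¬ P k := by
  obtain ⟨l, h1, h2, h3⟩ := exists_last_of_periodic (P := fun k => P (-k)) hd
    (fun k t => by rw [show -(k + d * t) = -k + d * (-t) by ring]; exact hP _ _)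
    (k₀ := -k₀) (by simpa using h₀) (-i)
  refine ⟨-l, by omega, h2, fun k h4 h5 hk => h3 (-k) (by omega) (by omega) (by simpa using hk)⟩

theorem le_of_step_up {f : ℤ → ℤ} {a b : ℤ} (h : ∀ k, a < k → k ≤ b → f (k - 1) ≤ f k)
    (hab : a ≤ b) : f a ≤ f b := by
  induction b, hab using Int.leInduction with
  | base => exact le_rfl
  | succ b hb ih =>
    have := h (b + 1) (by omega) le_rfl
    rw [add_sub_cancel_right] at this
    exact (ih fun k h1 h2 => h k h1 (by omega)).trans this

theorem le_of_step_down {f : ℤ → ℤ} {a b : ℤ} (h : ∀ k, a ≤ k → k < b → f (k + 1) ≤ f k)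
    (hab : a ≤ b) : f b ≤ f a := by
  have := le_of_step_up (f := fun k => - f k) (a := a) (b := b) (fun k h1 h2 => by
    have := h (k - 1) (by omega) (by omega)
    rw [sub_add_cancel] at this
    exact neg_le_neg this) hab
  exact neg_le_neg_iff.1 this

/-- Unless every vertex is obstructed by its predecessor, or every vertex by its successor, there
is a level interval `[l, r]` that can be raised without moving `l - 1` and `r + 1`; it can be found
inside any set of vertices closed under obstruction. -/
theorem exists_level_interval (hC : IsReflexiveCycle C) (hD : IsReflexiveCycle D) {f : ℤ → ℤ}
    (hf : IsLift C D w f) {k₁ k₂ : ℤ} (h₁ : Loose C D f k₁ (k₁ - 1))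
    (h₂ : Loose C D f k₂ (k₂ + 1)) {A : ℤ → Prop} {i : ℤ} (hi : A i)
    (hA : ∀ u v, u ≤ v + 1 → v ≤ u + 1 → A u → ¬ Loose C D f u v → A v) :
    ∃ l r a, l ≤ r ∧ Loose C D f l (l - 1) ∧ Loose C D f r (r + 1) ∧
      ∀ k, l ≤ k → k ≤ r → A k ∧ f k = a := by
  have hm : (0 : ℤ) < m := by have := hC.three_le; omega
  have hL : ∀ i, ∃ l ≤ i, Loose C D f l (l - 1) ∧ ∀ k, l < k → k ≤ i → ¬ Loose C D f k (k - 1) :=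
    exists_last_of_periodic hm (fun k t => by
      rw [← loose_add_mul hf k (k - 1) t, add_sub_right_comm]) h₁
  have hR : ∀ i, ∃ r ≥ i, Loose C D f r (r + 1) ∧ ∀ k, i ≤ k → k < r → ¬ Loose C D f k (k + 1) :=
    exists_first_of_periodic hm (fun k t => by
      rw [← loose_add_mul hf k (k + 1) t, add_right_comm]) h₂
  obtain ⟨l, hli, hl, hl'⟩ := hL i
  obtain ⟨r, hri, hr, hr'⟩ := hR i
  have hAl : ∀ k ≤ i, l ≤ k → A k := by
    intro k hk
    induction k, hk using Int.leInductionDown with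
    | base => exact fun _ => hi
    | pred k hk ih =>
      exact fun h => hA k (k - 1) (by omega) (by omega) (ih (by omega)) (hl' k (by omega) hk)
  have hAr : ∀ k ≥ i, k ≤ r → A k := by
    intro k hk
    induction k, hk using Int.leInduction with
    | base => exact fun _ => hi
    | succ k hk ih =>
      exact fun h => hA k (k + 1) (by omega) (by omega) (ih (by omega)) (hr' k hk (by omega))
  -- A lowest vertex of the closed interval `[l, r]` obstructs only vertices of its own level.
  obtain ⟨j, hj, hmin⟩ := Finset.exists_min_image (Finset.Icc l r) f
    ⟨i, Finset.mem_Icc.2 ⟨hli, hri⟩⟩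
  rw [Finset.mem_Icc] at hj
  obtain ⟨l', hlj, hl1, hl2⟩ := hL j
  obtain ⟨r', hrj, hr1, hr2⟩ := hR j
  have hll : l ≤ l' := by
    by_contra h
    exact hl2 l (by omega) hj.1 hl
  have hrr : r' ≤ r := by
    by_contra h
    exact hr2 r hj.2 (by omega) hr
  refine ⟨l', r', f j, by omega, hl1, hr1, fun k hk1 hk2 => ⟨?_, le_antisymm ?_ ?_⟩⟩
  · rcases le_total k i with h | h
    · exact hAl k h (by omega)
    · exact hAr k h (by omega)
  · rcases le_total k j with h | h
    · exact le_of_step_up (fun t h1 h2 => le_of_not_loose hC hD hf (by omega) (by omega)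
        (hl2 t (by omega) h2)) h
    · exact le_of_step_down (fun t h1 h2 => le_of_not_loose hC hD hf (by omega) (by omega)
        (hr2 t h1 (by omega))) h
  · exact hmin k (Finset.mem_Icc.2 ⟨by omega, by omega⟩)

/-- A level interval that is not obstructed from outside can be raised. -/
theorem exists_liftUp_of_level_interval (hC : IsReflexiveCycle C) (hD : IsReflexiveCycle D)
    {f g : ℤ → ℤ} (hf : IsLift C D w f) (hg : IsLift C D w g) (hfg : f ≤ g) {l r a : ℤ}
    (hlr : l ≤ r) (hl : Loose C D f l (l - 1)) (hr : Loose C D f r (r + 1))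
    (hk : ∀ k, l ≤ k → k ≤ r → f k < g k ∧ f k = a) :
    ∃ f', IsLift C D w f' ∧ LiftUp C D f f' ∧ f' ≤ g := by
  classical
  let S : ℤ → Prop := fun k => ∃ t : ℤ, l ≤ k + m * t ∧ k + m * t ≤ r
  have hSm : ∀ k, S (k + m) ↔ S k := fun k =>
    ⟨fun ⟨t, h⟩ => ⟨t + 1, by rwa [show k + m * (t + 1) = k + m + m * t by ring]⟩,
      fun ⟨t, h⟩ => ⟨t - 1, by rwa [show k + m + m * (t - 1) = k + m * t by ring]⟩⟩
  have hout : ∀ u v, u ≤ v + 1 → v ≤ u + 1 → S u → (S v → f v ≠ f u) → Loose C D f u v := by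
    rintro u v h1 h2 ⟨t, ht1, ht2⟩ hv
    have hin : ¬ (l ≤ v + m * t ∧ v + m * t ≤ r) := fun h => by
      have e1 := (hk _ h.1 h.2).2
      have e2 := (hk _ ht1 ht2).2
      rw [hf.period_mul] at e1 e2
      exact hv ⟨t, h⟩ (by omega)
    rw [← loose_add_mul hf u v t]
    rcases (by omega : v = u ∨ v = u - 1 ∨ v = u + 1) with rfl | rfl | rfl
    · exact absurd ⟨ht1, ht2⟩ hin
    · rw [← add_sub_right_comm]
      rwa [show u + m * t = l by omega]
    · rw [add_right_comm]
      rwa [show u + m * t = r by omega]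
  have hSS : ∀ u v, u ≤ v + 1 → v ≤ u + 1 → S u → S v → f u = f v := by
    intro u v h1 h2 hu hv
    by_contra hne
    exact hne (le_antisymm
      (le_of_loose hC h1 h2 (hout u v h1 h2 hu fun _ h => hne h.symm))
      (le_of_loose hC h2 h1 (hout v u h2 h1 hv fun _ h => hne h)))
  have hlev : ∀ u, S u → (lineAdj D (f u) (f u + 1) ↔ lineAdj D a (a + 1)) ∧
      (lineAdj D (f u + 1) (f u) ↔ lineAdj D (a + 1) a) := by
    rintro u ⟨t, ht1, ht2⟩
    have e := (hk _ ht1 ht2).2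
    rw [hf.period_mul] at e
    rw [← e, add_right_comm, lineAdj_add_mul, lineAdj_add_mul]
    exact ⟨Iff.rfl, Iff.rfl⟩
  let f' : ℤ → ℤ := fun k => if S k then f k + 1 else f k
  have hS : ∀ k, S k → f' k = f k + 1 := fun k h => if_pos h
  have hn : ∀ k, ¬ S k → f' k = f k := fun k h => if_neg h
  refine ⟨f', ⟨fun u v huv => ?_, fun k => ?_⟩, ⟨fun h => ?_, ?_, fun k => ?_⟩, fun k => ?_⟩
  · by_cases hu : S u <;> by_cases hv : S v
    · rw [hS u hu, hS v hv, hSS u v huv.2.1 huv.2.2 hu hv]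
      exact lineAdj_self hD _
    · rw [hS u hu, hn v hv]
      exact (hout u v huv.2.1 huv.2.2 hu fun h => absurd h hv).1 huv
    · rw [hn u hu, hS v hv]
      exact (hout v u huv.2.2 huv.2.1 hv fun h => absurd h hu).2 huv
    · rw [hn u hu, hn v hv]
      exact hf.hom u v huv
  · simp only [f', hSm, hf.period]
    split_ifs <;> ring
  · have := hS l ⟨0, by simpa using hlr⟩
    rw [← h] at this
    omega
  · rcases lineAdj_total hD a with ha | ha
    · refine Or.inl fun u v huv => ?_
      by_cases hv : S v
      · rw [hS v hv]
        by_cases hu : S u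
        · rw [← hSS u v huv.2.1 huv.2.2 hu hv]
          exact (hlev u hu).1.2 ha
        · exact (hout v u huv.2.2 huv.2.1 hv fun h => absurd h hu).2 huv
      · rw [hn v hv]
        exact hf.hom u v huv
    · refine Or.inr fun u v huv => ?_
      by_cases hu : S u
      · rw [hS u hu]
        by_cases hv : S v
        · rw [← hSS u v huv.2.1 huv.2.2 hu hv]
          exact (hlev u hu).2.2 ha
        · exact (hout u v huv.2.1 huv.2.2 hu fun h => absurd h hv).1 huv
      · rw [hn u hu]
        exact hf.hom u v huv
  · by_cases h : S k
    · exact Or.inr (hS k h)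
    · exact Or.inl (hn k h)
  · by_cases h : S k
    · rw [hS k h]
      obtain ⟨t, ht1, ht2⟩ := h
      have := (hk _ ht1 ht2).1
      rw [hf.period_mul, hg.period_mul] at this
      change f k + 1 ≤ g k
      omega
    · rw [hn k h]
      exact hfg k

theorem isLift_const (hD : IsReflexiveCycle D) (a : ℤ) : IsLift C D 0 fun _ => a :=
  ⟨fun _ _ _ => lineAdj_self hD a, fun _ => by simp⟩

theorem liftUp_const (hD : IsReflexiveCycle D) (a : ℤ) :
    LiftUp C D (fun _ => a) fun _ => a + 1 := by
  refine ⟨fun h => ?_, ?_, fun _ => Or.inr rfl⟩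
  · have := congrFun h 0
    simp at this
  · rcases lineAdj_total hD a with h | h
    · exact Or.inl fun _ _ _ => h
    · exact Or.inr fun _ _ _ => h

theorem IsLift.eq_const_of_monotone {f : ℤ → ℤ} (hf : IsLift C D 0 f) (hm : 0 < m)
    (h : Monotone f ∨ Antitone f) : f = fun _ => f 0 := by
  have key : ∀ k, f (m * k) = f 0 := fun k => by simpa using hf.period_mul 0 k
  have hm' : (1 : ℤ) ≤ m := by omega
  funext k
  have h1 : (m : ℤ) * (-|k|) ≤ k := by nlinarith [neg_abs_le k, abs_nonneg k]
  have h2 : k ≤ (m : ℤ) * |k| := by nlinarith [le_abs_self k, abs_nonneg k]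
  rcases h with h | h
  · exact le_antisymm ((h h2).trans_eq (key _)) ((key _).symm.trans_le (h h1))
  · exact le_antisymm ((h h1).trans_eq (key _)) ((key _).symm.trans_le (h h2))

theorem Locked.monotone (hC : IsReflexiveCycle C) (hD : IsReflexiveCycle D) {f : ℤ → ℤ}
    (hf : IsLift C D w f) (h : Locked C D f) : Monotone f := fun _ _ hab =>
  le_of_step_up (fun k _ _ => le_of_not_loose hC hD hf (by omega) (by omega) (h k)) hab

/-- A lift strictly below another can be raised without passing it, unless it is locked (and the
wind is positive). -/
theorem exists_liftUp_or_locked (hC : IsReflexiveCycle C) (hD : IsReflexiveCycle D)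
    {f g : ℤ → ℤ} (hf : IsLift C D w f) (hg : IsLift C D w g) (hfg : f ≤ g) (hne : f ≠ g) :
    (∃ f', IsLift C D w f' ∧ LiftUp C D f f' ∧ f' ≤ g) ∨
      (0 < w ∧ Locked C D f ∧ ∀ k, f k < g k) := by
  obtain ⟨i, hi⟩ : ∃ i, f i < g i := by
    by_contra! h
    exact hne (le_antisymm hfg h)
  have hm : (0 : ℤ) < m := by have := hC.three_le; omega
  have hn : (0 : ℤ) < n := by have := hD.three_le; omega
  have hA : ∀ u v, u ≤ v + 1 → v ≤ u + 1 → f u < g u → ¬ Loose C D f u v → f v < g v :=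
    fun u v h1 h2 h3 h4 => lt_of_not_loose hC hD hf hg hfg h1 h2 h3 h4
  have hconst : w = 0 → (Monotone f ∨ Antitone f) → (∀ k, f k < g k) →
      ∃ f', IsLift C D w f' ∧ LiftUp C D f f' ∧ f' ≤ g := by
    rintro rfl hmon hlt
    have hc := hf.eq_const_of_monotone (by omega) hmon
    refine ⟨fun _ => f 0 + 1, isLift_const hD _, ?_, fun k => ?_⟩
    · rw [hc]
      exact liftUp_const hD _
    · have := hlt k
      rw [hc] at this
      exact this
  by_cases h1 : Locked C D f
  · have hlt : ∀ k, f k < g k := by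
      have hdown : ∀ k ≤ i, f k < g k := by
        intro k hk
        induction k, hk using Int.leInductionDown with
        | base => exact hi
        | pred k hk ih => exact hA k (k - 1) (by omega) (by omega) ih (h1 k)
      intro k
      have := hdown (k + m * (-|k - i|)) (by nlinarith [le_abs_self (k - i), abs_nonneg (k - i)])
      rw [hf.period_mul, hg.period_mul] at this
      omega
    rcases Nat.eq_zero_or_pos w with hw | hw
    · exact Or.inl (hconst hw (Or.inl (h1.monotone hC hD hf)) hlt)
    · exact Or.inr ⟨hw, h1, hlt⟩
  left
  by_cases h2 : ∀ k, ¬ Loose C D f k (k + 1)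
  · have hlt : ∀ k, f k < g k := by
      have hup : ∀ k ≥ i, f k < g k := by
        intro k hk
        induction k, hk using Int.leInduction with
        | base => exact hi
        | succ k hk ih => exact hA k (k + 1) (by omega) (by omega) ih (h2 k)
      intro k
      have := hup (k + m * |k - i|) (by nlinarith [neg_abs_le (k - i), abs_nonneg (k - i)])
      rw [hf.period_mul, hg.period_mul] at this
      omega
    have hanti : Antitone f := fun a b hab =>
      le_of_step_down (fun k _ _ => le_of_not_loose hC hD hf (by omega) (by omega) (h2 k)) hab
    refine hconst ?_ (Or.inr hanti) hlt
    have h3 := hanti (show (0 : ℤ) ≤ 0 + m by omega)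
    rw [hf.period] at h3
    by_contra hw
    have : (0 : ℤ) < n * w := by positivity
    omega
  · unfold Locked at h1
    push Not at h1 h2
    obtain ⟨k₁, h₁⟩ := h1
    obtain ⟨k₂, h₂⟩ := h2
    obtain ⟨l, r, a, hlr, hl, hr, hk⟩ :=
      exists_level_interval hC hD hf h₁ h₂ (A := fun k => f k < g k) hi hA
    exact exists_liftUp_of_level_interval hC hD hf hg hfg hlr hl hr hk

/-! ### Orientation letters and locked lifts -/

theorem intCast_eq_of_abs_lt {a b : ℤ} (h : (a : ZMod n) = (b : ZMod n)) (hab : |a - b| < n) :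
    a = b := by
  have h1 := (ZMod.intCast_eq_intCast_iff_dvd_sub b a n).1 h.symm
  have := Int.eq_zero_of_abs_lt_dvd h1 hab
  omega

theorem edgeLetter_eq_sym_iff (G : Digraph (ZMod n)) (a : ℤ) :
    edgeLetter G a = Letter.sym ↔ lineAdj G a (a + 1) ∧ lineAdj G (a + 1) a := by
  have e1 : a ≤ a + 1 + 1 := by omega
  unfold edgeLetter lineAdj
  push_cast
  split_ifs <;> simp_all

theorem edgeLetter_eq_fwd_iff (G : Digraph (ZMod n)) (a : ℤ) :
    edgeLetter G a = Letter.fwd ↔ lineAdj G a (a + 1) ∧ ¬ lineAdj G (a + 1) a := by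
  have e1 : a ≤ a + 1 + 1 := by omega
  unfold edgeLetter lineAdj
  push_cast
  split_ifs <;> simp_all

theorem edgeLetter_eq_bwd_iff (G : Digraph (ZMod n)) (a : ℤ) :
    edgeLetter G a = Letter.bwd ↔ ¬ lineAdj G a (a + 1) := by
  have e1 : a ≤ a + 1 + 1 := by omega
  unfold edgeLetter lineAdj
  push_cast
  split_ifs <;> simp_all

/-- The edge `k, k + 1` of `C` can be mapped forward onto the edge `a, a + 1` of `D`. -/
def Advances (C : Digraph (ZMod m)) (D : Digraph (ZMod n)) (k a : ℤ) : Prop :=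
  edgeLetter D a = Letter.sym ∨ edgeLetter D a = edgeLetter C k

theorem advances_iff (hC : IsReflexiveCycle C) (hD : IsReflexiveCycle D) (k a : ℤ) :
    Advances C D k a ↔ (lineAdj C k (k + 1) → lineAdj D a (a + 1)) ∧
      (lineAdj C (k + 1) k → lineAdj D (a + 1) a) := by
  have h1 := lineAdj_total hC k
  have h2 := lineAdj_total hD a
  have e1 := edgeLetter_eq_sym_iff D a
  have e2 := edgeLetter_eq_fwd_iff D a
  have e3 := edgeLetter_eq_bwd_iff D a
  have f1 := edgeLetter_eq_sym_iff C k
  have f2 := edgeLetter_eq_fwd_iff C k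
  have f3 := edgeLetter_eq_bwd_iff C k
  unfold Advances
  rcases hx : edgeLetter D a <;> rcases hy : edgeLetter C k <;> simp_all

theorem not_loose_iff (hC : IsReflexiveCycle C) (hD : IsReflexiveCycle D) {f : ℤ → ℤ}
    (hf : IsLift C D w f) (k : ℤ) :
    ¬ Loose C D f (k + 1) k ↔
      (Advances C D k (f k) ∧ f (k + 1) = f k + 1) ∨
        (¬ Advances C D k (f k) ∧ f (k + 1) = f k) := by
  have h1 := hf.step hC (i := k) (j := k + 1) (by omega) (by omega)
  have h3 := hf.hom k (k + 1)
  have h4 := hf.hom (k + 1) k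
  constructor
  · intro h
    have h2 := le_of_not_loose hC hD hf (by omega) (by omega) h
    rcases (by omega : f (k + 1) = f k ∨ f (k + 1) = f k + 1) with e | e
    · refine Or.inr ⟨fun h' => h ?_, e⟩
      rw [advances_iff hC hD] at h'
      unfold Loose
      rw [e]
      exact ⟨h'.2, h'.1⟩
    · rw [e] at h3 h4
      exact Or.inl ⟨(advances_iff hC hD _ _).2 ⟨h3, h4⟩, e⟩
  · rintro (⟨-, e⟩ | ⟨h', e⟩) h
    · have := le_of_loose hC (by omega) (by omega) h
      omega
    · refine h' ((advances_iff hC hD _ _).2 ?_)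
      unfold Loose at h
      rw [e] at h
      exact ⟨h.2, h.1⟩

theorem locked_iff (hC : IsReflexiveCycle C) (hD : IsReflexiveCycle D) {f : ℤ → ℤ}
    (hf : IsLift C D w f) :
    Locked C D f ↔ ∀ k, (Advances C D k (f k) ∧ f (k + 1) = f k + 1) ∨
        (¬ Advances C D k (f k) ∧ f (k + 1) = f k) := by
  simp_rw [← not_loose_iff hC hD hf]
  refine ⟨fun h k => ?_, fun h k => ?_⟩
  · have := h (k + 1)
    rwa [add_sub_cancel_right] at this
  · have := h (k - 1)
    rwa [sub_add_cancel] at this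

/-- A lift of positive wind crosses every edge of the line forward. -/
theorem IsLift.exists_crossing (hC : IsReflexiveCycle C) (hD : IsReflexiveCycle D) {f : ℤ → ℤ}
    (hf : IsLift C D w f) (hw : 0 < w) (a : ℤ) : ∃ k, f k = a ∧ f (k + 1) = a + 1 := by
  have hn := hD.three_le
  have hN : (0 : ℤ) < n * w := by positivity
  have hm : (0 : ℤ) < m := by have := hC.three_le; omega
  obtain ⟨k, hk, hmax⟩ := Int.exists_greatest_of_bdd (P := fun k => ∀ j ≤ k, f j ≤ a) (by
    refine ⟨m * (|a - f 0| + 1), fun z hz => ?_⟩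
    by_contra hlt
    have := hz (0 + m * (|a - f 0| + 1)) (by omega)
    rw [hf.period_mul] at this
    nlinarith [le_abs_self (a - f 0), abs_nonneg (a - f 0)]) (by
    -- `f` is bounded above on `(-∞, 0]` by its maximum over one period.
    obtain ⟨j₀, -, hj₀⟩ := Finset.exists_max_image (Finset.Ico (0 : ℤ) m) f
      ⟨0, Finset.mem_Ico.2 ⟨le_rfl, hm⟩⟩
    refine ⟨m * (-|a - f j₀|), fun j hj => ?_⟩
    have h1 := hf.period_mul (j % m) (j / m)
    rw [Int.emod_add_mul_ediv] at h1
    have h2 := hj₀ (j % m) (Finset.mem_Ico.2 ⟨Int.emod_nonneg _ hm.ne', Int.emod_lt_of_pos _ hm⟩)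
    have h3 : j / m ≤ -|a - f j₀| := Int.ediv_le_of_le_mul hm (by linarith)
    nlinarith [neg_abs_le (a - f j₀), abs_nonneg (a - f j₀)])
  have h1 : ¬ f (k + 1) ≤ a := fun h => by
    have := hmax (k + 1) (fun j hj => by
      rcases hj.lt_or_eq with hj | rfl
      · exact hk j (by omega)
      · exact h)
    omega
  have h2 := hf.step hC (i := k) (j := k + 1) (by omega) (by omega)
  have h3 := hk k le_rfl
  exact ⟨k, by omega, by omega⟩

/-- Raising all vertices of a locked lift of positive wind at once is possible only if `D` is
symmetric and `C` is directed. -/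
theorem Locked.exceptional (hC : IsReflexiveCycle C) (hD : IsReflexiveCycle D) {p : ℤ → ℤ}
    (hp : IsLift C D w p) (hw : 0 < w) (hl : Locked C D p)
    (h : LiftAdj C D p (fun k => p k + 1) ∨ LiftAdj C D (fun k => p k + 1) p) :
    IsSymmetricCycle D ∧ IsDirectedCycle C := by
  change (∀ i j, lineAdj C i j → lineAdj D (p i) (p j + 1)) ∨
    (∀ i j, lineAdj C i j → lineAdj D (p i + 1) (p j)) at h
  have hsym : ∀ a : ℤ, lineAdj D a (a + 1) ∧ lineAdj D (a + 1) a := by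
    intro a
    obtain ⟨k, rfl, hk⟩ := hp.exists_crossing hC hD hw a
    rcases h with h | h
    · refine ⟨h k k (lineAdj_self hC k), ?_⟩
      rcases lineAdj_total hC k with h' | h'
      · have := (h _ _ h').2
        omega
      · rw [← hk]
        exact hp.hom _ _ h'
    · refine ⟨?_, h k k (lineAdj_self hC k)⟩
      rcases lineAdj_total hC k with h' | h'
      · rw [← hk]
        exact hp.hom _ _ h'
      · have := (h _ _ h').2
        omega
  have hS : IsSymmetricCycle D := fun i => by
    obtain ⟨a, rfl⟩ := ZMod.intCast_surjective i
    exact (edgeLetter_eq_sym_iff D a).2 (hsym a)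
  have hstep : ∀ k, p (k + 1) = p k + 1 := fun k => by
    rcases (locked_iff hC hD hp).1 hl k with h | h
    · exact h.2
    · exact absurd (Or.inl (hS _)) h.1
  refine ⟨hS, ?_⟩
  rcases h with h | h
  · refine Or.inr fun i => ?_
    obtain ⟨k, rfl⟩ := ZMod.intCast_surjective i
    refine (edgeLetter_eq_bwd_iff C k).2 fun h' => ?_
    have := (h _ _ h').2
    have := hstep k
    omega
  · refine Or.inl fun i => ?_
    obtain ⟨k, rfl⟩ := ZMod.intCast_surjective i
    have hb : ¬ lineAdj C (k + 1) k := fun h' => by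
      have := (h _ _ h').2
      have := hstep k
      omega
    exact (edgeLetter_eq_fwd_iff C k).2 ⟨(lineAdj_total hC k).resolve_right hb, hb⟩

/-- Outside the exceptional case, a locked lift is a barrier: no upward move passes it. -/
theorem Locked.barrier (hC : IsReflexiveCycle C) (hD : IsReflexiveCycle D) {p f g : ℤ → ℤ}
    (hp : IsLift C D w p) (hl : Locked C D p) (hw : 0 < w)
    (hne : ¬ (IsSymmetricCycle D ∧ IsDirectedCycle C)) (hg : IsLift C D w g) (hfp : f ≤ p)
    (hfg : LiftUp C D f g) : g ≤ p := by
  have hm : (0 : ℤ) < m := by have := hC.three_le; omega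
  by_contra hgp
  obtain ⟨i, hi⟩ : ∃ i, p i < g i := by
    by_contra! h
    exact hgp h
  have hdown : ∀ k ≤ i, p k < g k := by
    intro k hk
    induction k, hk using Int.leInductionDown with
    | base => exact hi
    | pred k hk ih =>
      by_contra hlt
      have h1 : f k ≤ p k := hfp k
      have h2 := hfg.raise k
      have h3 := hg.step hC (i := k) (j := k - 1) (by omega) (by omega)
      have h4 := le_of_not_loose hC hD hp (by omega) (by omega) (hl k)
      have e1 : g k = p k + 1 := by omega
      have e2 : g (k - 1) = p (k - 1) := by omega
      refine hl k ?_
      unfold Loose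
      rw [← e1, ← e2]
      exact ⟨hg.hom _ _, hg.hom _ _⟩
  have hall : ∀ k, p k < g k := fun k => by
    have := hdown (k + m * (-|k - i|)) (by nlinarith [le_abs_self (k - i), abs_nonneg (k - i)])
    rw [hp.period_mul, hg.period_mul] at this
    omega
  have hfe : f = p := funext fun k => by
    have h1 : f k ≤ p k := hfp k
    have := hall k
    have := hfg.raise k
    omega
  have hge : g = fun k => p k + 1 := funext fun k => by
    have h1 : f k ≤ p k := hfp k
    have := hall k
    have := hfg.raise k
    omega
  have := hfg.adj
  rw [hfe, hge] at this
  exact hne (hl.exceptional hC hD hp hw this)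

/-- In the exceptional case the whole of a locked lift can be raised. -/
theorem Locked.liftUp_of_exceptional (hC : IsReflexiveCycle C) (hD : IsReflexiveCycle D)
    {p : ℤ → ℤ} (hp : IsLift C D w p) (hl : Locked C D p) (hS : IsSymmetricCycle D)
    (hdir : IsDirectedCycle C) :
    IsLift C D w (fun k => p k + 1) ∧ LiftUp C D p fun k => p k + 1 := by
  have hsym : ∀ a b : ℤ, a ≤ b + 1 → b ≤ a + 1 → lineAdj D a b := by
    intro a b h1 h2
    rcases (by omega : b = a ∨ b = a + 1 ∨ a = b + 1) with rfl | rfl | rfl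
    · exact lineAdj_self hD _
    · exact ((edgeLetter_eq_sym_iff D a).1 (hS _)).1
    · exact ((edgeLetter_eq_sym_iff D b).1 (hS _)).2
  have hstep : ∀ k, p (k + 1) = p k + 1 := fun k => by
    rcases (locked_iff hC hD hp).1 hl k with h | h
    · exact h.2
    · exact absurd (Or.inl (hS _)) h.1
  refine ⟨⟨fun i j hij => ?_, fun i => ?_⟩, fun h => ?_, ?_, fun k => Or.inr rfl⟩
  · have := (hp.hom i j hij).2
    exact hsym _ _ (by omega) (by omega)
  · have := hp.period i
    omega
  · have := congrFun h 0
    simp at this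
  · rcases hdir with hd | hd
    · refine Or.inr fun i j hij => ?_
      change lineAdj D (p i + 1) (p j)
      rcases (by have := hij.2; omega : j = i ∨ j = i + 1 ∨ i = j + 1) with rfl | rfl | rfl
      · exact hsym _ _ (by omega) (by omega)
      · rw [hstep]
        exact lineAdj_self hD _
      · exact absurd hij ((edgeLetter_eq_fwd_iff C j).1 (hd _)).2
    · refine Or.inl fun i j hij => ?_
      change lineAdj D (p i) (p j + 1)
      rcases (by have := hij.2; omega : j = i ∨ j = i + 1 ∨ i = j + 1) with rfl | rfl | rfl
      · exact hsym _ _ (by omega) (by omega)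
      · exact absurd hij ((edgeLetter_eq_bwd_iff C i).1 (hd _))
      · rw [hstep]
        exact lineAdj_self hD _

/-! ### Lifts and homomorphisms -/

theorem eq_or_of_adj (hD : IsReflexiveCycle D) {a b : ZMod n} (h : D.Adj a b) :
    b = a ∨ b = a + 1 ∨ a = b + 1 := by
  by_cases hab : b = a
  · exact Or.inl hab
  · exact Or.inr ((hD.edge_iff a b (Ne.symm hab)).1 (Or.inl h))

theorem exists_lineAdj_of_adj (hD : IsReflexiveCycle D) {a b : ZMod n} (h : D.Adj a b) :
    ∃ i j : ℤ, (i : ZMod n) = a ∧ (j : ZMod n) = b ∧ lineAdj D i j := by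
  obtain ⟨i, rfl⟩ := ZMod.intCast_surjective a
  have key : ∀ e : ℤ, -1 ≤ e → e ≤ 1 → b = ((i + e : ℤ) : ZMod n) →
      ∃ i' j : ℤ, (i' : ZMod n) = i ∧ (j : ZMod n) = b ∧ lineAdj D i' j := by
    rintro e h1 h2 rfl
    exact ⟨i, i + e, rfl, rfl, h, by omega, by omega⟩
  rcases eq_or_of_adj hD h with e | e | e
  · exact key 0 (by omega) (by omega) (by rw [e]; simp)
  · exact key 1 (by omega) (by omega) (by rw [e]; simp)
  · exact key (-1) (by omega) (by omega) (by rw [Int.cast_add, e]; simp)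

theorem edgeIncrease_intCast (hn : 3 ≤ n) {d : ℤ} (h1 : -1 ≤ d) (h2 : d ≤ 1) :
    edgeIncrease (d : ZMod n) = d := by
  have key : ∀ e : ℤ, -1 ≤ e → e ≤ 1 → (d : ZMod n) = (e : ZMod n) → d = e := fun e h3 h4 h =>
    intCast_eq_of_abs_lt h (by rw [abs_lt]; omega)
  unfold edgeIncrease
  split_ifs with h3 h4
  · exact (key 1 (by omega) (by omega) (by simpa using h3)).symm
  · exact (key (-1) (by omega) (by omega) (by simpa using h4)).symm
  · rcases (by omega : d = -1 ∨ d = 0 ∨ d = 1) with rfl | rfl | rfl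
    · simp at h4
    · rfl
    · simp at h3

theorem edgeIncrease_bounds (d : ZMod n) : -1 ≤ edgeIncrease d ∧ edgeIncrease d ≤ 1 := by
  unfold edgeIncrease
  split_ifs <;> omega

theorem intCast_edgeIncrease {d : ZMod n} (h : d = 0 ∨ d = 1 ∨ d = -1) :
    ((edgeIncrease d : ℤ) : ZMod n) = d := by
  unfold edgeIncrease
  split_ifs <;> simp_all

theorem IsLift.intCast_apply_cast {f : ℤ → ℤ} (hf : IsLift C D w f) (k : ℤ) :
    ((f ((k : ZMod m).cast : ℤ) : ℤ) : ZMod n) = (f k : ZMod n) := by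
  have := hf.period_mul (k % m) (k / m)
  rw [Int.emod_add_mul_ediv] at this
  rw [ZMod.coe_intCast, this]
  push_cast
  simp

/-- The homomorphism induced by a lift. -/
noncomputable def IsLift.toDHom (hC : IsReflexiveCycle C) {f : ℤ → ℤ} (hf : IsLift C D w f) :
    DHom C D where
  toFun z := ((f (z.cast : ℤ) : ℤ) : ZMod n)
  map_rel' {a b} hab := by
    obtain ⟨i, j, rfl, rfl, hij⟩ := exists_lineAdj_of_adj hC hab
    rw [hf.intCast_apply_cast, hf.intCast_apply_cast]
    exact (hf.hom i j hij).1

theorem IsLift.toDHom_apply (hC : IsReflexiveCycle C) {f : ℤ → ℤ} (hf : IsLift C D w f) (k : ℤ) :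
    hf.toDHom hC (k : ZMod m) = (f k : ZMod n) :=
  hf.intCast_apply_cast k

theorem IsLift.wind_toDHom (hC : IsReflexiveCycle C) (hD : IsReflexiveCycle D) {f : ℤ → ℤ}
    (hf : IsLift C D w f) : wind (hf.toDHom hC) = w := by
  have hinc : ∀ i : ℕ, edgeIncrease (hf.toDHom hC ((i : ZMod m) + 1) - hf.toDHom hC (i : ZMod m)) =
      f ((i + 1 : ℕ) : ℤ) - f (i : ℤ) := fun i => by
    have h1 := hf.toDHom_apply hC i
    have h2 := hf.toDHom_apply hC ((i + 1 : ℕ) : ℤ)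
    have h3 := hf.step hC (i := i) (j := (i + 1 : ℕ)) (by push_cast; omega) (by push_cast; omega)
    simp only [Int.cast_natCast] at h1 h2
    rw [Nat.cast_add, Nat.cast_one] at h2
    rw [h1, h2, ← Int.cast_sub, edgeIncrease_intCast hD.three_le (by omega) (by omega)]
  have hper := hf.period 0
  rw [zero_add] at hper
  have hn : (n : ℚ) ≠ 0 := by have := hD.three_le; positivity
  have : increase (hf.toDHom hC) = n * w := by
    refine (Finset.sum_congr rfl fun i _ => hinc i).trans ?_
    rw [Finset.sum_range_sub (fun i : ℕ => f (i : ℤ))]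
    push_cast
    omega
  unfold wind
  rw [this]
  push_cast
  field_simp

/-- The homomorphism of wind `w` induced by a lift of wind `w`. -/
noncomputable def IsLift.toWindHom (hC : IsReflexiveCycle C) (hD : IsReflexiveCycle D)
    {f : ℤ → ℤ} (hf : IsLift C D w f) : WindHom C D w :=
  ⟨hf.toDHom hC, hf.wind_toDHom hC hD⟩

theorem IsLift.toWindHom_apply (hC : IsReflexiveCycle C) (hD : IsReflexiveCycle D)
    {f : ℤ → ℤ} (hf : IsLift C D w f) (k : ℤ) :
    (hf.toWindHom hC hD).1 (k : ZMod m) = (f k : ZMod n) :=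
  hf.intCast_apply_cast k

theorem IsLift.toWindHom_eq (hC : IsReflexiveCycle C) (hD : IsReflexiveCycle D)
    {f : ℤ → ℤ} (hf : IsLift C D w f) {φ : WindHom C D w}
    (h : ∀ k : ℤ, φ.1 (k : ZMod m) = (f k : ZMod n)) : hf.toWindHom hC hD = φ := by
  refine Subtype.ext (DFunLike.ext _ _ fun z => ?_)
  obtain ⟨k, rfl⟩ := ZMod.intCast_surjective z
  rw [hf.toWindHom_apply hC hD, h]

theorem exists_discrete_primitive (d : ℤ → ℤ) (a : ℤ) :
    ∃ f : ℤ → ℤ, f 0 = a ∧ ∀ k, f (k + 1) = f k + d k := by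
  refine ⟨fun k => a + ∑ i ∈ Finset.Ico 0 k, d i - ∑ i ∈ Finset.Ico k 0, d i, by simp, fun k => ?_⟩
  beta_reduce
  rcases le_or_gt 0 k with hk | hk
  · rw [Finset.Ico_eq_empty_of_le (a := k) (b := 0) hk,
      Finset.Ico_eq_empty_of_le (a := k + 1) (b := 0) (by omega),
      ← Finset.insert_Ico_right_eq_Ico_add_one hk, Finset.sum_insert (by simp)]
    simp only [Finset.sum_empty]
    ring
  · rw [Finset.Ico_eq_empty_of_le (a := 0) (b := k) hk.le,
      Finset.Ico_eq_empty_of_le (a := 0) (b := k + 1) (by omega),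
      ← Finset.insert_Ico_add_one_left_eq_Ico hk, Finset.sum_insert (by simp)]
    simp only [Finset.sum_empty]
    ring

theorem exists_isLift (hC : IsReflexiveCycle C) (hD : IsReflexiveCycle D) (φ : WindHom C D w) :
    ∃ (f : ℤ → ℤ) (hf : IsLift C D w f), hf.toWindHom hC hD = φ := by
  have hn : 3 ≤ n := hD.three_le
  let d : ℤ → ℤ := fun k => edgeIncrease (φ.1 ((k : ZMod m) + 1) - φ.1 (k : ZMod m))
  have hd : ∀ k : ℤ, ((d k : ℤ) : ZMod n) = φ.1 ((k : ZMod m) + 1) - φ.1 (k : ZMod m) := by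
    intro k
    refine intCast_edgeIncrease ?_
    have key : ∀ a b : ZMod n, D.Adj a b ∨ D.Adj b a → b - a = 0 ∨ b - a = 1 ∨ b - a = -1 := by
      rintro a b (h | h) <;> rcases eq_or_of_adj hD h with h | h | h <;> rw [h] <;> simp
    refine key _ _ ?_
    rcases lineAdj_total hC k with h | h
    · have := h.1
      push_cast at this
      exact Or.inl (φ.1.map_rel this)
    · have := h.1
      push_cast at this
      exact Or.inr (φ.1.map_rel this)
  obtain ⟨a, ha⟩ := ZMod.intCast_surjective (φ.1 0)
  obtain ⟨f, hf0, hfs⟩ := exists_discrete_primitive d a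
  have hφ : ∀ k : ℤ, φ.1 (k : ZMod m) = (f k : ZMod n) := by
    intro k
    induction k using Int.induction_on with
    | zero => rw [hf0, ha]; simp
    | succ k ih =>
      have h2 := hd k
      rw [ih] at h2
      rw [hfs, Int.cast_add (f k) (d k), h2, Int.cast_add, Int.cast_one]
      ring
    | pred k ih =>
      have h1 := hfs (-(k : ℤ) - 1)
      have h2 := hd (-(k : ℤ) - 1)
      rw [sub_add_cancel] at h1
      rw [h1, Int.cast_add, h2] at ih
      push_cast at ih ⊢
      rw [sub_add_cancel] at ih
      linear_combination ih
  have hdm : ∀ k, d (k + m) = d k := fun k => by simp [d]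
  have hper : ∀ i, f (i + m) = f i + n * w := by
    have h0 : f (0 + m) = f 0 + n * w := by
      have hw := φ.2
      have hn' : (n : ℚ) ≠ 0 := by positivity
      unfold wind at hw
      rw [div_eq_iff hn'] at hw
      have hw' : increase φ.1 = n * w := by
        have : ((increase φ.1 : ℤ) : ℚ) = ((n * w : ℤ) : ℚ) := by
          rw [hw]
          push_cast
          ring
        exact_mod_cast this
      have : increase φ.1 = ∑ i ∈ Finset.range m, (f ((i + 1 : ℕ) : ℤ) - f (i : ℤ)) := by
        refine Finset.sum_congr rfl fun i _ => ?_
        push_cast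
        rw [hfs]
        simp [d]
      rw [Finset.sum_range_sub (fun i : ℕ => f (i : ℤ))] at this
      push_cast at this
      rw [zero_add]
      omega
    intro i
    induction i using Int.induction_on with
    | zero => exact h0
    | succ k ih =>
      rw [add_right_comm, hfs, hfs, hdm]
      omega
    | pred k ih =>
      have h1 := hfs (-(k : ℤ) - 1)
      have h2 := hfs (-(k : ℤ) - 1 + m)
      rw [hdm, add_right_comm, sub_add_cancel] at h2
      rw [sub_add_cancel] at h1
      omega
  have hlift : IsLift C D w f := by
    refine IsLift.of_step hD (fun k => ?_) hper
    have hb := edgeIncrease_bounds (φ.1 ((k : ZMod m) + 1) - φ.1 (k : ZMod m))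
    have hs : f (k + 1) = f k + edgeIncrease (φ.1 ((k : ZMod m) + 1) - φ.1 (k : ZMod m)) := hfs k
    refine ⟨fun h => ⟨?_, by omega, by omega⟩, fun h => ⟨?_, by omega, by omega⟩⟩
    · rw [← hφ, ← hφ]
      exact φ.1.map_rel h.1
    · rw [← hφ, ← hφ]
      exact φ.1.map_rel h.1
  exact ⟨f, hlift, hlift.toWindHom_eq hC hD hφ⟩

/-- An arc of `D` between the residues of two integers at distance two is ruled out by any arc in
the corresponding direction between them: this is where `D` must be non-contractible, the only
critical case being that of the directed 3-cycles. -/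
theorem lineAdj_of_adj (hD : IsReflexiveCycle D) (hDnc : NonContractible D) {a c : ℤ}
    (h : D.Adj (a : ZMod n) (c : ZMod n)) (h1 : a ≤ c + 2) (h2 : c ≤ a + 2)
    (hup : c = a + 2 → lineAdj D a (a + 1) ∨ lineAdj D (a + 1) (a + 1 + 1))
    (hdown : a = c + 2 → lineAdj D (c + 1) c ∨ lineAdj D (c + 1 + 1) (c + 1)) :
    lineAdj D a c := by
  suffices c = a ∨ c = a + 1 ∨ a = c + 1 from ⟨h, by omega, by omega⟩
  have key : ∀ x y : ℤ, (x : ZMod n) = (y : ZMod n) → |x - y| < n → x = y :=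
    fun x y => intCast_eq_of_abs_lt
  rcases hDnc with hn | ⟨rfl, hdir⟩
  · rcases eq_or_of_adj hD h with h | h | h
    · exact Or.inl (key _ _ h (by rw [abs_lt]; omega))
    · exact Or.inr (Or.inl (key _ _ (by push_cast; exact h) (by rw [abs_lt]; omega)))
    · exact Or.inr (Or.inr (key _ _ (by push_cast; exact h) (by rw [abs_lt]; omega)))
  · have h3 : (3 : ZMod 3) = 0 := rfl
    by_contra hne
    rcases (by omega : c = a + 2 ∨ a = c + 2) with rfl | rfl
    · rcases hdir with hd | hd
      · refine ((edgeLetter_eq_fwd_iff D (a - 1)).1 (hd _)).2 ⟨?_, by omega, by omega⟩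
        convert h using 1
        · push_cast
          ring
        · push_cast
          linear_combination -h3
      · rcases hup rfl with h' | h'
        · exact (edgeLetter_eq_bwd_iff D _).1 (hd _) h'
        · exact (edgeLetter_eq_bwd_iff D _).1 (hd _) h'
    · rcases hdir with hd | hd
      · rcases hdown rfl with h' | h'
        · exact ((edgeLetter_eq_fwd_iff D _).1 (hd _)).2 h'
        · exact ((edgeLetter_eq_fwd_iff D _).1 (hd _)).2 h'
      · refine (edgeLetter_eq_bwd_iff D (c + 2)).1 (hd _) ⟨?_, by omega, by omega⟩
        convert h using 1
        push_cast
        linear_combination h3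

theorem lineAdj_trans (hD : IsReflexiveCycle D) (hDnc : NonContractible D) {a b c : ℤ}
    (hab : lineAdj D a b) (hbc : lineAdj D b c) (h : D.Adj (a : ZMod n) (c : ZMod n)) :
    lineAdj D a c := by
  have h1 := hab.2
  have h2 := hbc.2
  refine lineAdj_of_adj hD hDnc h (by omega) (by omega) (fun e => Or.inl ?_) fun e => Or.inl ?_
  · rwa [show a + 1 = b by omega]
  · rwa [show c + 1 = b by omega]

theorem lineAdj_of_common_source (hD : IsReflexiveCycle D) (hDnc : NonContractible D) {a b c : ℤ}
    (hab : lineAdj D a b) (hac : lineAdj D a c) (h : D.Adj (b : ZMod n) (c : ZMod n)) :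
    lineAdj D b c := by
  have h1 := hab.2
  have h2 := hac.2
  refine lineAdj_of_adj hD hDnc h (by omega) (by omega) (fun e => Or.inr ?_) fun e => Or.inl ?_
  · rwa [show b + 1 + 1 = c by omega, show b + 1 = a by omega]
  · rwa [show c + 1 = a by omega]

theorem lineAdj_of_common_target (hD : IsReflexiveCycle D) (hDnc : NonContractible D) {a b c : ℤ}
    (hac : lineAdj D a c) (hbc : lineAdj D b c) (h : D.Adj (a : ZMod n) (b : ZMod n)) :
    lineAdj D a b := by
  have h1 := hac.2
  have h2 := hbc.2
  refine lineAdj_of_adj hD hDnc h (by omega) (by omega) (fun e => Or.inl ?_) fun e => Or.inr ?_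
  · rwa [show a + 1 = c by omega]
  · rwa [show b + 1 + 1 = a by omega, show b + 1 = c by omega]

/-- Arcs of `Hom(C, D)` lift to the line, because a transitive triangle cannot wind around a
non-contractible cycle. -/
theorem liftAdj_of_adj (hC : IsReflexiveCycle C) (hD : IsReflexiveCycle D)
    (hDnc : NonContractible D) {f g : ℤ → ℤ} (hf : IsLift C D w f) (hg : IsLift C D w g)
    (h : ∀ i j, lineAdj C i j → D.Adj (f i : ZMod n) (g j : ZMod n)) (h1 : f 0 ≤ g 0 + 1)
    (h2 : g 0 ≤ f 0 + 1) : LiftAdj C D f g := by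
  have hstep : ∀ u v, (lineAdj C u v ∨ lineAdj C v u) → lineAdj D (f u) (g u) →
      lineAdj D (f v) (g v) := by
    rintro u v (huv | hvu) hu
    · exact lineAdj_of_common_source hD hDnc (hf.hom _ _ huv)
        (lineAdj_trans hD hDnc hu (hg.hom _ _ huv) (h _ _ huv)) (h _ _ (lineAdj_self hC v))
    · exact lineAdj_of_common_target hD hDnc
        (lineAdj_trans hD hDnc (hf.hom _ _ hvu) hu (h _ _ hvu)) (hg.hom _ _ hvu)
        (h _ _ (lineAdj_self hC v))
  have hall : ∀ k, lineAdj D (f k) (g k) := by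
    intro k
    induction k using Int.induction_on with
    | zero => exact ⟨h _ _ (lineAdj_self hC 0), h1, h2⟩
    | succ k ih => exact hstep _ _ (lineAdj_total hC k) ih
    | pred k ih =>
      have := lineAdj_total hC (-(k : ℤ) - 1)
      rw [sub_add_cancel] at this
      exact hstep _ _ this.symm ih
  exact fun i j hij => lineAdj_trans hD hDnc (hall i) (hg.hom _ _ hij) (h _ _ hij)

/-- Neighbours in `Hom_w(C, D)` lift to neighbours. -/
theorem exists_lift_of_adj (hC : IsReflexiveCycle C) (hD : IsReflexiveCycle D)
    (hDnc : NonContractible D) {f : ℤ → ℤ} (hf : IsLift C D w f) {ψ : WindHom C D w}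
    (h : (windGraph C D w).Adj (hf.toWindHom hC hD) ψ ∨
      (windGraph C D w).Adj ψ (hf.toWindHom hC hD)) :
    ∃ (g : ℤ → ℤ) (hg : IsLift C D w g), hg.toWindHom hC hD = ψ ∧
      (LiftAdj C D f g ∨ LiftAdj C D g f) := by
  obtain ⟨g₀, hg₀, rfl⟩ := exists_isLift hC hD ψ
  have hadj : ∀ {f g : ℤ → ℤ} (hf : IsLift C D w f) (hg : IsLift C D w g),
      (windGraph C D w).Adj (hf.toWindHom hC hD) (hg.toWindHom hC hD) →
      ∀ i j, lineAdj C i j → D.Adj (f i : ZMod n) (g j : ZMod n) := by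
    intro f g hf hg h i j hij
    rw [← hf.toWindHom_apply hC hD, ← hg.toWindHom_apply hC hD]
    exact h _ _ hij.1
  have h0 : (g₀ 0 : ZMod n) = f 0 ∨ (g₀ 0 : ZMod n) = f 0 + 1 ∨ (f 0 : ZMod n) = g₀ 0 + 1 := by
    rcases h with h | h
    · exact eq_or_of_adj hD (hadj hf hg₀ h 0 0 (lineAdj_self hC 0))
    · rcases eq_or_of_adj hD (hadj hg₀ hf h 0 0 (lineAdj_self hC 0)) with h | h | h
      · exact Or.inl h.symm
      · exact Or.inr (Or.inr h)
      · exact Or.inr (Or.inl h)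
  obtain ⟨t, e, he1, he2, ht⟩ : ∃ t e : ℤ, -1 ≤ e ∧ e ≤ 1 ∧ f 0 + e = g₀ 0 + n * t := by
    have key : ∀ e : ℤ, (g₀ 0 : ZMod n) = ((f 0 + e : ℤ) : ZMod n) →
        ∃ t, f 0 + e = g₀ 0 + n * t := fun e he => by
      obtain ⟨t, ht⟩ := (ZMod.intCast_eq_intCast_iff_dvd_sub _ _ _).1 he
      exact ⟨t, by omega⟩
    rcases h0 with h | h | h
    · obtain ⟨t, ht⟩ := key 0 (by simpa using h)
      exact ⟨t, 0, by omega, by omega, ht⟩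
    · obtain ⟨t, ht⟩ := key 1 (by push_cast; exact h)
      exact ⟨t, 1, by omega, by omega, ht⟩
    · obtain ⟨t, ht⟩ := key (-1) (by push_cast; rw [h]; ring)
      exact ⟨t, -1, by omega, by omega, ht⟩
  have hg := hg₀.add_mul t
  have hgg : hg.toWindHom hC hD = hg₀.toWindHom hC hD := hg.toWindHom_eq hC hD fun k => by
    rw [hg₀.toWindHom_apply hC hD]
    push_cast
    simp
  refine ⟨_, hg, hgg, ?_⟩
  rw [← hgg] at h
  rcases h with h | h
  · exact Or.inl (liftAdj_of_adj hC hD hDnc hf hg (hadj hf hg h) (by omega) (by omega))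
  · exact Or.inr (liftAdj_of_adj hC hD hDnc hg hf (hadj hg hf h) (by omega) (by omega))

theorem LiftAdj.windGraph_adj (hC : IsReflexiveCycle C) (hD : IsReflexiveCycle D) {f g : ℤ → ℤ}
    (hf : IsLift C D w f) (hg : IsLift C D w g) (h : LiftAdj C D f g) :
    (windGraph C D w).Adj (hf.toWindHom hC hD) (hg.toWindHom hC hD) := by
  intro u v huv
  obtain ⟨i, j, rfl, rfl, hij⟩ := exists_lineAdj_of_adj hC huv
  rw [hf.toWindHom_apply hC hD, hg.toWindHom_apply hC hD]
  exact (h i j hij).1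

theorem LiftUp.upEdge (hC : IsReflexiveCycle C) (hD : IsReflexiveCycle D) {f g : ℤ → ℤ}
    (hf : IsLift C D w f) (hg : IsLift C D w g) (h : LiftUp C D f g) :
    UpEdge (hf.toWindHom hC hD) (hg.toWindHom hC hD) := by
  refine ⟨fun he => h.ne (funext fun k => ?_), ?_, fun v hv => ?_⟩
  · have h1 := hf.toWindHom_apply hC hD k
    rw [he, hg.toWindHom_apply hC hD] at h1
    have := h.raise k
    have := hD.three_le
    exact (intCast_eq_of_abs_lt h1 (by rw [abs_lt]; omega)).symm
  · exact h.adj.imp (fun h => h.windGraph_adj hC hD hf hg) fun h => h.windGraph_adj hC hD hg hf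
  · obtain ⟨k, rfl⟩ := ZMod.intCast_surjective v
    rw [hf.toWindHom_apply hC hD, hg.toWindHom_apply hC hD] at hv ⊢
    rcases h.raise k with e | e
    · exact absurd (by rw [e]) hv
    · rw [e]
      push_cast
      rfl

theorem exists_liftUp_of_upEdge (hC : IsReflexiveCycle C) (hD : IsReflexiveCycle D)
    (hDnc : NonContractible D) {f : ℤ → ℤ} (hf : IsLift C D w f) {ψ : WindHom C D w}
    (h : UpEdge (hf.toWindHom hC hD) ψ) :
    ∃ (g : ℤ → ℤ) (hg : IsLift C D w g), hg.toWindHom hC hD = ψ ∧ LiftUp C D f g := by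
  obtain ⟨g, hg, rfl, hfg⟩ := exists_lift_of_adj hC hD hDnc hf h.2.1
  have hn := hD.three_le
  refine ⟨g, hg, rfl, fun he => h.1 ?_, hfg, fun k => ?_⟩
  · subst he
    rfl
  · have hd : f k ≤ g k + 1 ∧ g k ≤ f k + 1 := by
      rcases hfg with h | h
      · exact (h k k (lineAdj_self hC k)).2
      · exact (h k k (lineAdj_self hC k)).2.symm
    have hk := h.2.2 (k : ZMod m)
    rw [hf.toWindHom_apply hC hD, hg.toWindHom_apply hC hD] at hk
    by_cases he : (g k : ZMod n) = f k
    · exact Or.inl (intCast_eq_of_abs_lt he (by rw [abs_lt]; omega))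
    · have h3 : ((g k - 1 : ℤ) : ZMod n) = (f k : ZMod n) := by
        push_cast
        rw [hk he]
        ring
      have h4 : g k - 1 = f k ∨ g k - 1 = f k - 1 ∨ g k - 1 = f k - 2 := by omega
      have := intCast_eq_of_abs_lt h3 (by rw [abs_lt]; omega)
      omega

/-! ### Greedy walks -/

open Classical in
/-- The greedy walk: starting from `a` it reads the edges of `C` from the base-point on and
advances whenever the current edge of `C` can be mapped forward. -/
noncomputable def greedy (C : Digraph (ZMod m)) (D : Digraph (ZMod n)) (a : ℤ) : ℕ → ℤ
  | 0 => a
  | k + 1 => if Advances C D k (greedy C D a k) then greedy C D a k + 1 else greedy C D a k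

theorem greedy_succ_cases (C : Digraph (ZMod m)) (D : Digraph (ZMod n)) (a : ℤ) (k : ℕ) :
    (Advances C D k (greedy C D a k) ∧ greedy C D a (k + 1) = greedy C D a k + 1) ∨
      (¬ Advances C D k (greedy C D a k) ∧ greedy C D a (k + 1) = greedy C D a k) := by
  by_cases h : Advances C D k (greedy C D a k)
  · exact Or.inl ⟨h, if_pos h⟩
  · exact Or.inr ⟨h, if_neg h⟩

theorem greedy_monotone (C : Digraph (ZMod m)) (D : Digraph (ZMod n)) (a : ℤ) :
    Monotone (greedy C D a) :=
  monotone_nat_of_le_succ fun k => by rcases greedy_succ_cases C D a k with h | h <;> omega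

theorem greedy_mono_left (C : Digraph (ZMod m)) (D : Digraph (ZMod n)) {a b : ℤ} (hab : a ≤ b)
    (k : ℕ) : greedy C D a k ≤ greedy C D b k := by
  induction k with
  | zero => exact hab
  | succ k ih =>
    rcases ih.eq_or_lt with h | h
    · rw [greedy, greedy, h]
    · have h1 := greedy_succ_cases C D a k
      have h2 := greedy_succ_cases C D b k
      omega

theorem greedy_add {s : ℤ}
    (hs : ∀ a : ℤ, edgeLetter D ((a + s : ℤ) : ZMod n) = edgeLetter D (a : ZMod n))
    (C : Digraph (ZMod m)) (a : ℤ) (k : ℕ) :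
    greedy C D (a + s) k = greedy C D a k + s := by
  induction k with
  | zero => rfl
  | succ k ih =>
    have : Advances C D k (greedy C D a k + s) ↔ Advances C D k (greedy C D a k) := by
      unfold Advances
      rw [hs]
    rw [greedy, greedy, ih]
    by_cases h : Advances C D k (greedy C D a k)
    · rw [if_pos h, if_pos (this.2 h)]
      ring
    · rw [if_neg h, if_neg fun h' => h (this.1 h')]

/-- Greedy walks commute with translations by multiples of a period of `D`. -/
theorem greedy_add_mul {s : ℤ}
    (hs : ∀ a : ℤ, edgeLetter D ((a + s : ℤ) : ZMod n) = edgeLetter D (a : ZMod n))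
    (C : Digraph (ZMod m)) (a t : ℤ) (k : ℕ) :
    greedy C D (a + s * t) k = greedy C D a k + s * t := by
  induction t using Int.induction_on with
  | zero => simp
  | succ t ih =>
    rw [show a + s * ((t : ℤ) + 1) = a + s * t + s by ring, greedy_add hs, ih]
    ring
  | pred t ih =>
    have := greedy_add hs C (a + s * (-(t : ℤ) - 1)) k
    rw [show a + s * (-(t : ℤ) - 1) + s = a + s * (-t) by ring, ih] at this
    linarith

theorem exists_greedy_crossing (C : Digraph (ZMod m)) (D : Digraph (ZMod n)) {a b : ℤ} {k : ℕ}
    (hab : a ≤ b) (hb : b < greedy C D a k) :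
    ∃ j < k, greedy C D a j = b ∧ greedy C D a (j + 1) = b + 1 := by
  induction k with
  | zero => exact absurd hb (not_lt.2 hab)
  | succ k ih =>
    by_cases h : b < greedy C D a k
    · obtain ⟨j, hj, h'⟩ := ih h
      exact ⟨j, by omega, h'⟩
    · have := greedy_succ_cases C D a k
      exact ⟨k, by omega, by omega, by omega⟩

theorem length_orientationString (C : Digraph (ZMod m)) : (orientationString C).length = m := by
  simp [orientationString]

theorem getElem_orientationString (C : Digraph (ZMod m)) {k : ℕ}
    (h : k < (orientationString C).length) :
    (orientationString C)[k] = edgeLetter C (k : ZMod m) := by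
  simp [orientationString, ← List.map_eq_flatMap]

/-- Greedy matching is optimal: a segment of the string of `D` embeds into the string of `C`
exactly when the greedy walk from its start traverses it. -/
theorem starSub_iff_le_greedy (C : Digraph (ZMod m)) (D : Digraph (ZMod n)) {Z : List Letter}
    {i : ℤ} (hZ : ∀ j < Z.length, Z[j]? = some (edgeLetter D ((i + j : ℤ) : ZMod n))) :
    StarSub Z (orientationString C) ↔ i + Z.length ≤ greedy C D i m := by
  have hlen := length_orientationString C
  have hget : ∀ j : Fin Z.length, Z.get j = edgeLetter D ((i + (j : ℕ) : ℤ) : ZMod n) := fun j => by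
    have := hZ j j.2
    rw [List.getElem?_eq_getElem j.2] at this
    exact Option.some.inj this
  have hget' : ∀ k : Fin (orientationString C).length,
      (orientationString C).get k = edgeLetter C ((((k : ℕ) : ℤ)) : ZMod m) := fun k => by
    rw [List.get_eq_getElem, getElem_orientationString, Int.cast_natCast]
  have hadv : ∀ (j : Fin Z.length) (k : Fin (orientationString C).length),
      (Z.get j = Letter.sym ∨ Z.get j = (orientationString C).get k) ↔
        Advances C D ((k : ℕ) : ℤ) (i + (j : ℕ)) := fun j k => by
    rw [hget, hget']
    rfl
  constructor
  · rintro ⟨α, hα, hm⟩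
    have key : ∀ (j : ℕ) (hj : j < Z.length), i + j + 1 ≤ greedy C D i (α ⟨j, hj⟩ + 1) := by
      intro j
      induction j with
      | zero =>
        intro hj
        have h1 := greedy_monotone C D i (Nat.zero_le (α ⟨0, hj⟩))
        have h2 := (hadv _ _).1 (hm ⟨0, hj⟩)
        have h3 := greedy_succ_cases C D i (α ⟨0, hj⟩)
        change i ≤ _ at h1
        rcases h1.eq_or_lt with h | h
        · rw [← h] at h3
          simp only [Nat.cast_zero, add_zero] at h2 ⊢
          rcases h3 with h3 | h3
          · omega
          · exact absurd h2 h3.1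
        · push_cast
          omega
      | succ j ih =>
        intro hj
        have h0 := ih (by omega)
        have hlt : (α ⟨j, by omega⟩ : ℕ) < α ⟨j + 1, hj⟩ := hα (by simp)
        have h1 := h0.trans (greedy_monotone C D i hlt)
        have h2 := (hadv _ _).1 (hm ⟨j + 1, hj⟩)
        have h3 := greedy_succ_cases C D i (α ⟨j + 1, hj⟩)
        push_cast at h2 ⊢
        rw [← add_assoc] at h2
        rcases h1.eq_or_lt with h | h
        · rw [← h] at h3
          rcases h3 with h3 | h3
          · omega
          · exact absurd h2 h3.1
        · omega
    rcases Nat.eq_zero_or_pos Z.length with h | h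
    · have := greedy_monotone C D i (Nat.zero_le m)
      change i ≤ _ at this
      omega
    · have h1 := key (Z.length - 1) (by omega)
      have h2 := (α ⟨Z.length - 1, by omega⟩).2
      have h3 := greedy_monotone C D i
        (show (α ⟨Z.length - 1, by omega⟩ : ℕ) + 1 ≤ m by omega)
      omega
  · intro h
    have hex : ∀ j : Fin Z.length, ∃ k < m, greedy C D i k = i + (j : ℕ) ∧
        greedy C D i (k + 1) = i + (j : ℕ) + 1 := fun j =>
      exists_greedy_crossing C D (by omega) (by have := j.2; omega)
    choose κ hκ h1 h2 using hex
    refine ⟨fun j => ⟨κ j, by rw [hlen]; exact hκ j⟩, fun j j' hjj => ?_, fun j => ?_⟩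
    · change κ j < κ j'
      by_contra hle
      have := greedy_monotone C D i (not_lt.1 hle)
      rw [h1, h1] at this
      have : (j : ℕ) < j' := hjj
      omega
    · refine (hadv _ _).2 ?_
      have h3 := greedy_succ_cases C D i (κ j)
      rw [h1, h2] at h3
      rcases h3 with h3 | h3
      · exact h3.1
      · omega

/-! ### Strings of powers of the root -/

theorem length_power (Y : List Letter) (k : ℕ) : (power Y k).length = k * Y.length := by
  simp [power]

theorem getElem?_power (Y : List Letter) {k j : ℕ} (h : j < k * Y.length) :
    (power Y k)[j]? = Y[j % Y.length]? := by
  induction k generalizing j with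
  | zero => simp at h
  | succ k ih =>
    have e : power Y (k + 1) = Y ++ power Y k := by simp [power, List.replicate_succ]
    rw [e, List.getElem?_append]
    split_ifs with hj
    · rw [Nat.mod_eq_of_lt hj]
    · rw [ih (by rw [Nat.succ_mul] at h; omega), ← Nat.mod_eq_sub_mod (by omega)]

theorem length_root (hY : power Y r = orientationString D) : r * Y.length = n := by
  rw [← length_power, hY, length_orientationString]

theorem getElem?_root (hD : IsReflexiveCycle D) (hY : power Y r = orientationString D) (a : ℤ) :
    Y[(a % Y.length).toNat]? = some (edgeLetter D (a : ZMod n)) := by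
  have hn := hD.three_le
  have hlen := length_root hY
  have h1 := Int.emod_nonneg a (show (n : ℤ) ≠ 0 by omega)
  have h2 := Int.emod_lt_of_pos a (show (0 : ℤ) < n by omega)
  obtain ⟨j, hj⟩ := Int.eq_ofNat_of_zero_le h1
  have hjn : j < n := by omega
  have hja : (j : ZMod n) = (a : ZMod n) := by
    rw [← Int.cast_natCast, ← hj]
    simp
  have h3 : (orientationString D)[j]? = some (edgeLetter D (j : ZMod n)) := by
    have hj' : j < (orientationString D).length := by rwa [length_orientationString]
    rw [List.getElem?_eq_getElem hj', getElem_orientationString]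
  rw [← hY, getElem?_power Y (by rwa [hlen]), hja] at h3
  rw [← h3]
  congr 1
  have h4 : a % Y.length = (a % n) % Y.length :=
    (Int.emod_emod_of_dvd a ⟨r, by rw [← hlen]; push_cast; ring⟩).symm
  rw [h4, hj]
  norm_cast

theorem edgeLetter_add_root (hD : IsReflexiveCycle D) (hY : power Y r = orientationString D)
    (a : ℤ) :
    edgeLetter D ((a + Y.length : ℤ) : ZMod n) = edgeLetter D (a : ZMod n) := by
  have h1 := getElem?_root hD hY a
  have h2 := getElem?_root hD hY (a + Y.length)
  rw [Int.add_emod_right, h1] at h2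
  exact (Option.some.inj h2).symm

theorem getElem?_root_natCast (hD : IsReflexiveCycle D) (hY : power Y r = orientationString D)
    (i j : ℕ) : Y[(i + j) % Y.length]? = some (edgeLetter D ((i + j : ℤ) : ZMod n)) := by
  have := getElem?_root hD hY (i + j)
  rw [← this]
  congr 1

theorem length_root_pos (hD : IsReflexiveCycle D) (hY : power Y r = orientationString D) :
    0 < Y.length := by
  have hn := hD.three_le
  have := length_root hY
  exact Nat.pos_of_ne_zero fun h => by rw [h] at this; omega

theorem starSub_power_rotate (C : Digraph (ZMod m)) (hD : IsReflexiveCycle D)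
    (hY : power Y r = orientationString D) (i k : ℕ) :
    StarSub (power (Y.rotate i) k) (orientationString C) ↔
      (i : ℤ) + k * Y.length ≤ greedy C D i m := by
  have hs := length_root_pos hD hY
  have hlen : (power (Y.rotate i) k).length = k * Y.length := by
    rw [length_power, List.length_rotate]
  rw [starSub_iff_le_greedy C D (i := i), hlen]
  · push_cast
    rfl
  · intro j hj
    rw [hlen] at hj
    rw [getElem?_power _ (by rwa [List.length_rotate]), List.length_rotate,
      List.getElem?_rotate (Nat.mod_lt _ hs), Nat.mod_add_mod, add_comm,
      getElem?_root_natCast hD hY]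

theorem starSub_rotate_power (C : Digraph (ZMod m)) (hD : IsReflexiveCycle D)
    (hY : power Y r = orientationString D) (i k : ℕ) :
    StarSub ((power Y k).rotate i) (orientationString C) ↔
      (i : ℤ) + k * Y.length ≤ greedy C D i m := by
  have hlen : ((power Y k).rotate i).length = k * Y.length := by
    rw [List.length_rotate, length_power]
  rw [starSub_iff_le_greedy C D (i := i), hlen]
  · push_cast
    rfl
  · intro j hj
    rw [hlen] at hj
    have hpos : 0 < k * Y.length := by omega
    rw [List.getElem?_rotate (by rwa [length_power]), length_power,
      getElem?_power _ (Nat.mod_lt _ hpos), Nat.mod_mod_of_dvd _ (Dvd.intro_left k rfl), add_comm,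
      getElem?_root_natCast hD hY]

theorem starSub_extendedPower (C : Digraph (ZMod m)) (hD : IsReflexiveCycle D)
    (hY : power Y r = orientationString D) (i k : ℕ) :
    StarSub (extendedPower Y i k) (orientationString C) ↔
      (i : ℤ) + k * Y.length < greedy C D i m := by
  have hs := length_root_pos hD hY
  have hlen : (extendedPower Y i k).length = k * Y.length + 1 := by
    unfold extendedPower
    rw [List.length_append, length_power, List.length_rotate, List.length_take,
      List.length_rotate, min_eq_left hs]
  rw [starSub_iff_le_greedy C D (i := i), hlen]
  · push_cast
    omega
  · intro j hj
    rw [hlen] at hj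
    unfold extendedPower
    rw [List.getElem?_append, length_power, List.length_rotate]
    split_ifs with h
    · rw [getElem?_power _ (by rwa [List.length_rotate]), List.length_rotate,
        List.getElem?_rotate (Nat.mod_lt _ hs), Nat.mod_add_mod, add_comm,
        getElem?_root_natCast hD hY]
    · obtain rfl : j = k * Y.length := by omega
      rw [Nat.sub_self, List.getElem?_take_of_lt one_pos, List.getElem?_rotate hs, zero_add,
        ← getElem?_root_natCast hD hY, Nat.add_mul_mod_self_right]

/-! ### Lifts from greedy walks -/

theorem exists_periodic_extension (hm : 0 < m) {h : ℕ → ℤ} {N : ℤ} (hh : h m = h 0 + N) :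
    ∃ f : ℤ → ℤ, ∀ (j : ℕ) (t : ℤ), j ≤ m → f (j + m * t) = h j + N * t := by
  have hm' : (0 : ℤ) < m := by omega
  have key : ∀ (j : ℕ) (t : ℤ), j < m →
      h (((j : ℤ) + m * t) % m).toNat + N * (((j : ℤ) + m * t) / m) = h j + N * t := by
    intro j t hj
    rw [Int.add_mul_emod_self_left, Int.emod_eq_of_lt (by omega) (by omega),
      Int.add_mul_ediv_left _ _ hm'.ne', Int.ediv_eq_zero_of_lt (by omega) (by omega)]
    simp
  refine ⟨fun k => h (k % m).toNat + N * (k / m), fun j t hj => ?_⟩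
  rcases hj.lt_or_eq with hj | rfl
  · exact key j t hj
  · have := key 0 (t + 1) hm
    rw [show ((0 : ℕ) : ℤ) + j * (t + 1) = j + j * t by push_cast; ring] at this
    beta_reduce
    rw [this, hh]
    ring

theorem exists_residue (hm : 0 < m) (k : ℤ) : ∃ (j : ℕ) (t : ℤ), j < m ∧ k = j + m * t := by
  have hm' : (0 : ℤ) < m := by omega
  have h1 := Int.emod_nonneg k hm'.ne'
  have h2 := Int.emod_lt_of_pos k hm'
  refine ⟨(k % m).toNat, k / m, by omega, ?_⟩
  rw [Int.toNat_of_nonneg h1, Int.emod_add_mul_ediv]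

theorem advances_add_mul (C : Digraph (ZMod m)) (D : Digraph (ZMod n)) (k a t u : ℤ) :
    Advances C D (k + m * t) (a + n * u) ↔ Advances C D k a := by
  unfold Advances
  push_cast
  simp

/-- A periodic walk that only advances along edges that can be mapped forward is a lift. -/
theorem isLift_of_advances (hC : IsReflexiveCycle C) (hD : IsReflexiveCycle D) {h : ℕ → ℤ}
    (hs : ∀ j < m, h (j + 1) = h j ∨ (Advances C D j (h j) ∧ h (j + 1) = h j + 1)) {f : ℤ → ℤ}
    (hf : ∀ (j : ℕ) (t : ℤ), j ≤ m → f (j + m * t) = h j + n * w * t) : IsLift C D w f := by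
  have hm : 0 < m := by have := hC.three_le; omega
  refine IsLift.of_step hD (fun k => ?_) fun k => ?_
  · obtain ⟨j, t, hj, rfl⟩ := exists_residue hm k
    have e1 := hf j t hj.le
    have e2 := hf (j + 1) t hj
    rw [show ((j + 1 : ℕ) : ℤ) + m * t = j + m * t + 1 by push_cast; ring] at e2
    rcases hs j hj with h1 | ⟨h1, h2⟩
    · rw [e2, e1, h1]
      exact ⟨fun _ => lineAdj_self hD _, fun _ => lineAdj_self hD _⟩
    · rw [← advances_add_mul C D _ _ t (w * t), ← mul_assoc, ← e1, advances_iff hC hD] at h1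
      rwa [show f (j + m * t + 1) = f (j + m * t) + 1 by omega]
  · obtain ⟨j, t, hj, rfl⟩ := exists_residue hm k
    have e1 := hf j t hj.le
    have e2 := hf j (t + 1) hj.le
    rw [show (j : ℤ) + m * (t + 1) = j + m * t + m by ring] at e2
    rw [e1, e2]
    ring

/-- If the greedy walk from `a` covers `w` turns of `D`, there is a lift of wind `w`. -/
theorem exists_isLift_of_le_greedy (hC : IsReflexiveCycle C) (hD : IsReflexiveCycle D) {a : ℤ}
    (ha : a + n * w ≤ greedy C D a m) : ∃ f, IsLift C D w f := by
  have hm : 0 < m := by have := hC.three_le; omega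
  have hnw : (0 : ℤ) ≤ n * w := by positivity
  let h : ℕ → ℤ := fun j => min (greedy C D a j) (a + n * w)
  have h0 : h 0 = a := min_eq_left (by change a ≤ _; omega)
  have hh : h m = h 0 + n * w := by
    rw [h0]
    exact min_eq_right ha
  obtain ⟨f, hf⟩ := exists_periodic_extension hm hh
  refine ⟨f, isLift_of_advances hC hD (fun j _ => ?_) hf⟩
  have hs := greedy_succ_cases C D a j
  rcases le_or_gt (a + n * w) (greedy C D a j) with hle | hlt
  · refine Or.inl ?_
    change min _ _ = min _ _
    omega
  · have e1 : h j = greedy C D a j := min_eq_left hlt.le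
    have e2 : h (j + 1) = greedy C D a (j + 1) := min_eq_left (by omega)
    rw [e1, e2]
    rcases hs with hs | hs
    · exact Or.inr hs
    · exact Or.inl hs.2

/-- A greedy walk that covers exactly `w` turns of `D` closes up to a locked lift. -/
theorem exists_locked_of_greedy_eq (hC : IsReflexiveCycle C) (hD : IsReflexiveCycle D) {a : ℤ}
    (ha : greedy C D a m = a + n * w) : ∃ f, IsLift C D w f ∧ Locked C D f ∧ f 0 = a := by
  have hm : 0 < m := by have := hC.three_le; omega
  obtain ⟨f, hf⟩ := exists_periodic_extension (h := greedy C D a) hm ha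
  have hlift := isLift_of_advances hC hD (fun j _ => by
    rcases greedy_succ_cases C D a j with h | h
    · exact Or.inr h
    · exact Or.inl h.2) hf
  refine ⟨f, hlift, (locked_iff hC hD hlift).2 fun k => ?_, ?_⟩
  · obtain ⟨j, t, hj, rfl⟩ := exists_residue hm k
    have e1 := hf j t hj.le
    have e2 := hf (j + 1) t hj
    rw [show ((j + 1 : ℕ) : ℤ) + m * t = j + m * t + 1 by push_cast; ring] at e2
    have h1 := greedy_succ_cases C D a j
    rw [← advances_add_mul C D _ _ t (w * t), ← mul_assoc, ← e1] at h1
    rw [e2]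
    rcases h1 with h1 | h1
    · exact Or.inl ⟨h1.1, by omega⟩
    · exact Or.inr ⟨h1.1, by omega⟩
  · have := hf 0 0 (Nat.zero_le m)
    simpa [greedy] using this

theorem IsLift.le_greedy (hC : IsReflexiveCycle C) (hD : IsReflexiveCycle D) {f : ℤ → ℤ}
    (hf : IsLift C D w f) (k : ℕ) : f k ≤ greedy C D (f 0) k := by
  induction k with
  | zero => exact le_rfl
  | succ k ih =>
    have h1 := greedy_succ_cases C D (f 0) k
    have h2 := hf.step hC (i := k) (j := k + 1) (by omega) (by omega)
    push_cast
    by_cases h3 : f k + 1 ≤ greedy C D (f 0) (k + 1)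
    · omega
    · have e : f k = greedy C D (f 0) k := by omega
      have h4 : ¬ Advances C D k (f k) := by
        rw [e]
        rcases h1 with h1 | h1
        · omega
        · exact h1.1
      by_contra h5
      have e2 : f (k + 1) = f k + 1 := by omega
      refine h4 ((advances_iff hC hD _ _).2 ?_)
      rw [← e2]
      exact ⟨hf.hom _ _, hf.hom _ _⟩

theorem IsLift.add_le_greedy (hC : IsReflexiveCycle C) (hD : IsReflexiveCycle D) {f : ℤ → ℤ}
    (hf : IsLift C D w f) : f 0 + n * w ≤ greedy C D (f 0) m := by
  have := hf.le_greedy hC hD m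
  have h := hf.period 0
  rw [zero_add] at h
  omega

theorem Locked.eq_greedy (hC : IsReflexiveCycle C) (hD : IsReflexiveCycle D) {f : ℤ → ℤ}
    (hf : IsLift C D w f) (hl : Locked C D f) (k : ℕ) : f k = greedy C D (f 0) k := by
  induction k with
  | zero => rfl
  | succ k ih =>
    have h1 := greedy_succ_cases C D (f 0) k
    have h2 := (locked_iff hC hD hf).1 hl k
    rw [← ih] at h1
    push_cast
    rcases h1 with h1 | h1 <;> rcases h2 with h2 | h2
    · omega
    · exact absurd h1.1 h2.1
    · exact absurd h2.1 h1.1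
    · omega

theorem Locked.greedy_eq (hC : IsReflexiveCycle C) (hD : IsReflexiveCycle D) {f : ℤ → ℤ}
    (hf : IsLift C D w f) (hl : Locked C D f) : greedy C D (f 0) m = f 0 + n * w := by
  have h := hf.period 0
  rw [zero_add] at h
  rw [← hl.eq_greedy hC hD hf m, h]

theorem Locked.ext (hC : IsReflexiveCycle C) (hD : IsReflexiveCycle D) {f g : ℤ → ℤ}
    (hf : IsLift C D w f) (hlf : Locked C D f) (hg : IsLift C D w g) (hlg : Locked C D g)
    (h : f 0 = g 0) : f = g := by
  funext k
  obtain ⟨j, t, hj, rfl⟩ := exists_residue (m := m) (by have := hC.three_le; omega) k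
  rw [hf.period_mul, hg.period_mul, hlf.eq_greedy hC hD hf, hlg.eq_greedy hC hD hg, h]

/-! ### Components -/

theorem LiftUp.sum_lt (hC : IsReflexiveCycle C) {f g : ℤ → ℤ} (hf : IsLift C D w f)
    (hg : IsLift C D w g) (h : LiftUp C D f g) :
    ∑ k ∈ Finset.range m, f k < ∑ k ∈ Finset.range m, g k := by
  obtain ⟨i, hi⟩ : ∃ i, f i ≠ g i := by
    by_contra! h'
    exact h.ne (funext h')
  obtain ⟨j, t, hj, rfl⟩ := exists_residue (m := m) (by have := hC.three_le; omega) i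
  rw [hf.period_mul, hg.period_mul] at hi
  refine Finset.sum_lt_sum (fun k _ => h.le k) ⟨j, Finset.mem_range.2 hj, ?_⟩
  have : f j ≤ g j := h.le j
  omega

/-- If a lift can be raised below `g` as long as it does not satisfy `P`, then raising it
repeatedly ends at a lift that satisfies `P`. -/
theorem exists_reflTransGen_upEdge (hC : IsReflexiveCycle C) (hD : IsReflexiveCycle D)
    {P : (ℤ → ℤ) → Prop} {g : ℤ → ℤ}
    (hprog : ∀ f, IsLift C D w f → f ≤ g → ¬ P f →
      ∃ f', IsLift C D w f' ∧ LiftUp C D f f' ∧ f' ≤ g)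
    {f : ℤ → ℤ} (hf : IsLift C D w f) (hfg : f ≤ g) :
    ∃ (p : ℤ → ℤ) (hp : IsLift C D w p), p ≤ g ∧ P p ∧
      Relation.ReflTransGen UpEdge (hf.toWindHom hC hD) (hp.toWindHom hC hD) := by
  obtain ⟨N, hN⟩ : ∃ N : ℕ, ∑ k ∈ Finset.range m, g k ≤ ∑ k ∈ Finset.range m, f k + N :=
    ⟨(∑ k ∈ Finset.range m, g k - ∑ k ∈ Finset.range m, f k).toNat, by omega⟩
  induction N generalizing f with
  | zero =>
    by_cases hP : P f
    · exact ⟨f, hf, hfg, hP, .refl⟩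
    · obtain ⟨f', hf', hup, hle⟩ := hprog f hf hfg hP
      have h1 := hup.sum_lt hC hf hf'
      have h2 : ∑ k ∈ Finset.range m, f' k ≤ ∑ k ∈ Finset.range m, g k :=
        Finset.sum_le_sum fun k _ => hle k
      push_cast at hN
      omega
  | succ N ih =>
    by_cases hP : P f
    · exact ⟨f, hf, hfg, hP, .refl⟩
    · obtain ⟨f', hf', hup, hle⟩ := hprog f hf hfg hP
      have h1 := hup.sum_lt hC hf hf'
      push_cast at hN
      obtain ⟨p, hp, hpg, hPp, hgen⟩ := ih hf' hle (by omega)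
      exact ⟨p, hp, hpg, hPp, .head (hup.upEdge hC hD hf hf') hgen⟩

theorem exists_translate_gt (hC : IsReflexiveCycle C) (hD : IsReflexiveCycle D) {f g : ℤ → ℤ}
    (hf : IsLift C D w f) (hg : IsLift C D w g) : ∃ t : ℤ, ∀ k, f k < g k + n * t := by
  have hm : 0 < m := by have := hC.three_le; omega
  have hn : (3 : ℤ) ≤ n := by have := hD.three_le; omega
  obtain ⟨i, -, hi⟩ := Finset.exists_max_image (Finset.range m) (fun k : ℕ => f k - g k)
    ⟨0, Finset.mem_range.2 hm⟩
  refine ⟨|f i - g i| + 1, fun k => ?_⟩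
  obtain ⟨j, t, hj, rfl⟩ := exists_residue hm k
  have := hi j (Finset.mem_range.2 hj)
  rw [hf.period_mul, hg.period_mul]
  nlinarith [le_abs_self (f i - g i), abs_nonneg (f i - g i)]

theorem IsLift.toWindHom_add_mul (hC : IsReflexiveCycle C) (hD : IsReflexiveCycle D)
    {f : ℤ → ℤ} (hf : IsLift C D w f) (t : ℤ) :
    (hf.add_mul t).toWindHom hC hD = hf.toWindHom hC hD :=
  (hf.add_mul t).toWindHom_eq hC hD fun k => by
    rw [hf.toWindHom_apply hC hD]
    push_cast
    simp

theorem Locked.add_mul (hC : IsReflexiveCycle C) (hD : IsReflexiveCycle D) {f : ℤ → ℤ}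
    (hf : IsLift C D w f) (hl : Locked C D f) (t : ℤ) : Locked C D fun k => f k + n * t := by
  refine (locked_iff hC hD (hf.add_mul t)).2 fun k => ?_
  have h := (locked_iff hC hD hf).1 hl k
  rw [← advances_add_mul C D k (f k) 0 t, mul_zero, add_zero] at h
  refine h.imp (fun h => ⟨h.1, ?_⟩) fun h => ⟨h.1, ?_⟩
  · rw [h.2]
    ring
  · rw [h.2]

theorem UpEdge.adj {φ ψ : WindHom C D w} (h : UpEdge φ ψ) :
    (windGraph C D w).toSimpleGraphInclusive.Adj φ ψ :=
  ⟨h.1, h.2.1⟩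

/-- If no lift gets stuck below another one, `Hom_w(C, D)` is a single cyclic component. -/
theorem isSingleCyclic_of_progress (hC : IsReflexiveCycle C) (hD : IsReflexiveCycle D)
    {f₀ : ℤ → ℤ} (hf₀ : IsLift C D w f₀)
    (hprog : ∀ f g, IsLift C D w f → IsLift C D w g → f ≤ g → f ≠ g →
      ∃ f', IsLift C D w f' ∧ LiftUp C D f f' ∧ f' ≤ g) : IsSingleCyclic C D w := by
  have key : ∀ φ ψ : WindHom C D w, Relation.TransGen UpEdge φ ψ := by
    intro φ ψ
    obtain ⟨f, hf, rfl⟩ := exists_isLift hC hD φ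
    obtain ⟨g, hg, rfl⟩ := exists_isLift hC hD ψ
    obtain ⟨t, ht⟩ := exists_translate_gt hC hD hf hg
    rw [← hg.toWindHom_add_mul hC hD t]
    obtain ⟨f', hf', hup, hle⟩ := hprog _ _ hf (hg.add_mul t) (fun k => (ht k).le) fun h =>
      (ht 0).ne (congrFun h 0)
    obtain ⟨p, hp, -, rfl, hgen⟩ := exists_reflTransGen_upEdge hC hD
      (P := fun f => f = fun k => g k + n * t)
      (fun f hf hle hne => hprog f _ hf (hg.add_mul t) hle hne) hf' hle
    exact .head' (hup.upEdge hC hD hf hf') hgen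
  refine ⟨SimpleGraph.connectedComponentMk _ (hf₀.toWindHom hC hD), fun K' => ?_,
    fun φ ψ _ _ => key φ ψ⟩
  induction K' using SimpleGraph.ConnectedComponent.ind with
  | h φ =>
    refine SimpleGraph.ConnectedComponent.eq.2 ((SimpleGraph.reachable_iff_reflTransGen _ _).2 ?_)
    exact Relation.ReflTransGen.mono (fun _ _ => UpEdge.adj) _ _ (key _ _).to_reflTransGen

/-- Connected maps have lifts below the same locked lifts. -/
theorem exists_lift_of_reachable (hC : IsReflexiveCycle C) (hD : IsReflexiveCycle D)
    (hDnc : NonContractible D) (hw : 0 < w) (hne : ¬ (IsSymmetricCycle D ∧ IsDirectedCycle C))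
    {f : ℤ → ℤ} (hf : IsLift C D w f) {ψ : WindHom C D w}
    (h : (windGraph C D w).toSimpleGraphInclusive.Reachable (hf.toWindHom hC hD) ψ) :
    ∃ (g : ℤ → ℤ) (hg : IsLift C D w g), hg.toWindHom hC hD = ψ ∧
      ∀ p, IsLift C D w p → Locked C D p → (f ≤ p ↔ g ≤ p) := by
  rw [SimpleGraph.reachable_iff_reflTransGen] at h
  induction h with
  | refl => exact ⟨f, hf, rfl, fun _ _ _ => Iff.rfl⟩
  | tail _ hadj ih =>
    obtain ⟨g, hg, rfl, hgp⟩ := ih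
    obtain ⟨g', hg', rfl, hgg⟩ := exists_lift_of_adj hC hD hDnc hg hadj.2
    refine ⟨g', hg', rfl, fun p hp hl => (hgp p hp hl).trans ?_⟩
    have key : ∀ {g g' : ℤ → ℤ}, IsLift C D w g → IsLift C D w g' → LiftAdj C D g g' →
        (g ≤ p ↔ g' ≤ p) := by
      intro g g' hg hg' hgg
      obtain ⟨hs, h1, h2⟩ := hgg.sup hC hD hg hg'
      have hd : ∀ k, g k ≤ g' k + 1 ∧ g' k ≤ g k + 1 := fun k => (hgg k k (lineAdj_self hC k)).2
      constructor
      · intro hgp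
        by_cases he : g = g ⊔ g'
        · exact (le_sup_right.trans he.ge).trans hgp
        · refine le_sup_right.trans (hl.barrier hC hD hp hw hne hs hgp ⟨he, Or.inl h1, fun k => ?_⟩)
          have := hd k
          change max _ _ = _ ∨ max _ _ = _
          omega
      · intro hgp
        by_cases he : g' = g ⊔ g'
        · exact (le_sup_left.trans he.ge).trans hgp
        · refine le_sup_left.trans (hl.barrier hC hD hp hw hne hs hgp ⟨he, Or.inr h2, fun k => ?_⟩)
          have := hd k
          change max _ _ = _ ∨ max _ _ = _
          omega
    rcases hgg with h | h
    · exact key hg hg' h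
    · exact (key hg' hg h).symm

/-- If there is a locked lift, every map is connected to one that has a locked lift. -/
theorem exists_locked_reachable (hC : IsReflexiveCycle C) (hD : IsReflexiveCycle D)
    {p₀ : ℤ → ℤ} (hp₀ : IsLift C D w p₀) (hl₀ : Locked C D p₀) (φ : WindHom C D w) :
    ∃ (p : ℤ → ℤ) (hp : IsLift C D w p), Locked C D p ∧
      (windGraph C D w).toSimpleGraphInclusive.Reachable φ (hp.toWindHom hC hD) := by
  obtain ⟨f, hf, rfl⟩ := exists_isLift hC hD φ
  obtain ⟨t, ht⟩ := exists_translate_gt hC hD hf hp₀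
  have hl := hl₀.add_mul hC hD hp₀ t
  obtain ⟨p, hp, -, hlp, hgen⟩ := exists_reflTransGen_upEdge hC hD (P := Locked C D)
    (g := fun k => p₀ k + n * t) (fun f hf hle hlf => by
      rcases exists_liftUp_or_locked hC hD hf (hp₀.add_mul t) hle
        (fun h => hlf (h ▸ hl)) with h | h
      · exact h
      · exact absurd h.2.1 hlf) hf fun k => (ht k).le
  exact ⟨p, hp, hlp, (SimpleGraph.reachable_iff_reflTransGen _ _).2
    (Relation.ReflTransGen.mono (fun _ _ => UpEdge.adj) _ _ hgen)⟩

/-- Outside the exceptional case, if there is a locked lift then no component is cyclic. -/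
theorem not_isCyclicComponent_of_locked (hC : IsReflexiveCycle C) (hD : IsReflexiveCycle D)
    (hDnc : NonContractible D) (hw : 0 < w) (hne : ¬ (IsSymmetricCycle D ∧ IsDirectedCycle C))
    {p₀ : ℤ → ℤ} (hp₀ : IsLift C D w p₀) (hl₀ : Locked C D p₀) (K : WindComponent C D w) :
    ¬ IsCyclicComponent K := by
  intro hK
  induction K using SimpleGraph.ConnectedComponent.ind with
  | h φ =>
    obtain ⟨p, hp, hl, hr⟩ := exists_locked_reachable hC hD hp₀ hl₀ φ
    have hmem : hp.toWindHom hC hD ∈ ((windGraph C D w).toSimpleGraphInclusive.connectedComponentMk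
        φ).supp :=
      SimpleGraph.ConnectedComponent.eq.2 hr.symm
    obtain ⟨ψ, hψ, -⟩ := Relation.TransGen.head'_iff.1 (hK _ _ hmem hmem)
    obtain ⟨g, hg, rfl, hup⟩ := exists_liftUp_of_upEdge hC hD hDnc hp hψ
    exact hup.ne (le_antisymm hup.le (hl.barrier hC hD hp hw hne hg le_rfl hup))

/-- Outside the exceptional case, if there is a locked lift then the components correspond to the
starting points from which the greedy walk covers exactly `w` turns of `D`. -/
theorem card_windComponent_of_locked (hC : IsReflexiveCycle C) (hD : IsReflexiveCycle D)
    (hDnc : NonContractible D) (hw : 0 < w) (hne : ¬ (IsSymmetricCycle D ∧ IsDirectedCycle C))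
    {p₀ : ℤ → ℤ} (hp₀ : IsLift C D w p₀) (hl₀ : Locked C D p₀) {P : ℕ → Prop} [DecidablePred P]
    (hP : ∀ i : ℕ, P i ↔ greedy C D i m = i + n * w) :
    Nat.card (WindComponent C D w) = ((Finset.range n).filter P).card := by
  have hn : 0 < n := by have := hD.three_le; omega
  have hex : ∀ i : (Finset.range n).filter P, ∃ f, IsLift C D w f ∧ Locked C D f ∧ f 0 = (i : ℕ) :=
    fun i => exists_locked_of_greedy_eq hC hD ((hP i).1 (Finset.mem_filter.1 i.2).2)
  choose F hF hlF hF0 using hex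
  rw [← Nat.card_eq_finsetCard]
  symm
  refine Nat.card_eq_of_bijective (fun i => SimpleGraph.connectedComponentMk _
    ((hF i).toWindHom hC hD)) ⟨fun i j hij => ?_, fun K => ?_⟩
  · obtain ⟨g, hg, hgj, hgp⟩ := exists_lift_of_reachable hC hD hDnc hw hne (hF i)
      (SimpleGraph.ConnectedComponent.eq.1 hij)
    -- `g` is a translate of the locked lift `F j`, hence locked.
    have hgl : Locked C D g := by
      refine (locked_iff hC hD hg).2 fun k => ?_
      have h1 := (locked_iff hC hD (hF j)).1 (hlF j) k
      have hval : ∀ k : ℤ, (g k : ZMod n) = (F j k : ZMod n) := fun k => by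
        rw [← hg.toWindHom_apply hC hD, hgj, (hF j).toWindHom_apply hC hD]
      have hadv : Advances C D k (g k) ↔ Advances C D k (F j k) := by
        unfold Advances
        rw [hval]
      have hstep := hg.step hC (i := k) (j := k + 1) (by omega) (by omega)
      have h3 := hD.three_le
      rw [hadv]
      have hdiff : ((g (k + 1) - g k : ℤ) : ZMod n) = ((F j (k + 1) - F j k : ℤ) : ZMod n) := by
        push_cast
        rw [hval, hval]
      have := intCast_eq_of_abs_lt hdiff (by rw [abs_lt]; omega)
      exact h1.imp (fun h => ⟨h.1, by omega⟩) fun h => ⟨h.1, by omega⟩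
    have h1 : F i = g := le_antisymm ((hgp g hg hgl).2 le_rfl) ((hgp _ (hF i) (hlF i)).1 le_rfl)
    have h2 : (F i 0 : ZMod n) = (F j 0 : ZMod n) := by
      rw [h1, ← hg.toWindHom_apply hC hD, hgj, (hF j).toWindHom_apply hC hD]
    have hi := Finset.mem_range.1 (Finset.mem_filter.1 i.2).1
    have hj := Finset.mem_range.1 (Finset.mem_filter.1 j.2).1
    rw [hF0, hF0] at h2
    have := intCast_eq_of_abs_lt h2 (by rw [abs_lt]; omega)
    exact Subtype.ext (by omega)
  · induction K using SimpleGraph.ConnectedComponent.ind with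
    | h φ =>
      obtain ⟨p, hp, hl, hr⟩ := exists_locked_reachable hC hD hp₀ hl₀ φ
      obtain ⟨i, t, hi, hpt⟩ := exists_residue hn (p 0)
      have hg := hl.greedy_eq hC hD hp
      rw [hpt, greedy_add_mul (s := n) (fun a => by simp)] at hg
      have hPi : P i := (hP i).2 (by omega)
      let i' : (Finset.range n).filter P := ⟨i, Finset.mem_filter.2 ⟨Finset.mem_range.2 hi, hPi⟩⟩
      have hl' := (hlF i').add_mul hC hD (hF i') t
      have he : p = fun k => F i' k + n * t :=
        Locked.ext hC hD hp hl ((hF i').add_mul t) hl' (by rw [hpt]; simp only [hF0]; rfl)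
      refine ⟨i', ?_⟩
      refine SimpleGraph.ConnectedComponent.eq.2 ?_
      rw [← (hF i').toWindHom_add_mul hC hD t]
      subst he
      exact hr.symm

/-- The constant maps form a copy of `D` in `Hom_0(C, D)`. -/
theorem nonempty_relEmbedding_windGraph_zero (hC : IsReflexiveCycle C) (hD : IsReflexiveCycle D) :
    Nonempty (D.Adj ↪r (windGraph C D 0).Adj) := by
  have happ : ∀ (z : ZMod n) (u : ZMod m),
      ((isLift_const (C := C) hD (z.cast : ℤ)).toWindHom hC hD).1 u = z := fun z u => by
    obtain ⟨k, rfl⟩ := ZMod.intCast_surjective u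
    rw [IsLift.toWindHom_apply]
    simp
  refine ⟨⟨⟨fun z => (isLift_const hD (z.cast : ℤ)).toWindHom hC hD, fun z z' h => ?_⟩,
    fun {z z'} => ⟨fun h => ?_, fun h u v _ => ?_⟩⟩⟩
  · beta_reduce at h
    rw [← happ z 0, h, happ z' 0]
  · have := h 0 0 (hC.loop 0)
    change D.Adj (((isLift_const hD (z.cast : ℤ)).toWindHom hC hD).1 0)
      (((isLift_const hD (z'.cast : ℤ)).toWindHom hC hD).1 0) at this
    rwa [happ, happ] at this
  · change D.Adj (((isLift_const hD (z.cast : ℤ)).toWindHom hC hD).1 u)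
      (((isLift_const hD (z'.cast : ℤ)).toWindHom hC hD).1 v)
    rwa [happ, happ]

/-! ### Comparison of the wind with the longest embedded power of the root -/

/-- By monotonicity, if some greedy walk covers at least `w` turns and some at most `w` turns, one
covers exactly `w` turns. -/
theorem exists_greedy_eq {s : ℤ} (hs : 0 < s)
    (hper : ∀ a : ℤ, edgeLetter D ((a + s : ℤ) : ZMod n) = edgeLetter D (a : ZMod n))
    (C : Digraph (ZMod m)) {N a b : ℤ} (ha : a + N ≤ greedy C D a m)
    (hb : greedy C D b m ≤ b + N) : ∃ c, greedy C D c m = c + N := by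
  have hb' : greedy C D (b + s * |a - b|) m ≤ b + s * |a - b| + N := by
    rw [greedy_add_mul hper]
    omega
  have hab : a ≤ b + s * |a - b| := by nlinarith [le_abs_self (a - b), abs_nonneg (a - b)]
  generalize b + s * |a - b| = b' at hb' hab
  obtain ⟨c, ⟨hcb, hc⟩, hmax⟩ := Int.exists_greatest_of_bdd
    (P := fun c => c ≤ b' ∧ c + N ≤ greedy C D c m) ⟨b', fun z hz => hz.1⟩ ⟨a, hab, ha⟩
  refine ⟨c, le_antisymm ?_ hc⟩
  have h1 := greedy_mono_left C D hcb m
  have h2 := greedy_mono_left C D (show c ≤ greedy C D c m - N by omega) m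
  have := hmax (greedy C D c m - N) ⟨by omega, by omega⟩
  omega

end CycleRecon

open CycleRecon
open Classical in
theorem theorem1 {m n : ℕ} (C : Digraph (ZMod m)) (D : Digraph (ZMod n))
    (hC : IsReflexiveCycle C) (hD : IsReflexiveCycle D) (hDnc : NonContractible D)
    (Y : List Letter) (r : ℕ) (hY : IsRoot Y r (orientationString D))
    (R : ℕ)
    (hR : IsGreatest
      {k : ℕ | ∃ i : ℕ, StarSub ((power Y k).rotate i) (orientationString C)} R)
    (w : ℕ) :
    -- wind zero
    (w = 0 → IsSingleCyclic C D w ∧ Nonempty (D.Adj ↪r (windGraph C D w).Adj)) ∧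
    -- positive wind, outside the exceptional case
    (¬ (IsSymmetricCycle D ∧ IsDirectedCycle C) →
      (0 < w →
        ((w : ℚ) < (R : ℚ) / r ∨
          ((w : ℚ) = (R : ℚ) / r ∧
            ∀ i < Y.length, StarSub (extendedPower Y i (w * r)) (orientationString C))) →
        IsSingleCyclic C D w) ∧
      (0 < w → (w : ℚ) = (R : ℚ) / r →
        (¬ ∀ i < Y.length, StarSub (extendedPower Y i (w * r)) (orientationString C)) →
        Nat.card (WindComponent C D w) =
            ((Finset.range n).filter fun i =>
              StarSub (power (Y.rotate i) (w * r)) (orientationString C) ∧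
              ¬ StarSub (extendedPower Y i (w * r)) (orientationString C)).card ∧
          ∀ K : WindComponent C D w, ¬ IsCyclicComponent K)) ∧
    -- positive wind, in the exceptional case
    (IsSymmetricCycle D ∧ IsDirectedCycle C →
      0 < w → (w : ℚ) ≤ (R : ℚ) / r → IsSingleCyclic C D w) ∧
    -- large wind
    ((R : ℚ) / r < (w : ℚ) → IsEmpty (WindHom C D w)) := by
  have hY' := hY.1
  have hs := length_root_pos hD hY'
  have hlen := length_root hY'
  have hper := edgeLetter_add_root hD hY'
  have hr : 0 < r := Nat.pos_of_ne_zero fun h => by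
    have := hD.three_le
    rw [h] at hlen
    omega
  have hrQ : (0 : ℚ) < r := by exact_mod_cast hr
  have hlt : (w : ℚ) < (R : ℚ) / r ↔ w * r < R := by
    rw [lt_div_iff₀ hrQ]
    exact_mod_cast Iff.rfl
  have heq : (w : ℚ) = (R : ℚ) / r ↔ w * r = R := by
    rw [eq_div_iff hrQ.ne']
    exact_mod_cast Iff.rfl
  have hle : (w : ℚ) ≤ (R : ℚ) / r ↔ w * r ≤ R := by
    rw [le_div_iff₀ hrQ]
    exact_mod_cast Iff.rfl
  have hnw : ((w * r : ℕ) : ℤ) * Y.length = n * w := by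
    rw [← hlen]
    push_cast
    ring
  simp only [starSub_extendedPower C hD hY', starSub_power_rotate C hD hY',
    starSub_rotate_power C hD hY', hnw] at hR ⊢
  obtain ⟨⟨a, ha⟩, hmax⟩ := hR
  have hnonempty : w * r ≤ R → (a : ℤ) + n * w ≤ greedy C D a m := fun h => by
    rw [← hnw]
    have : ((w * r : ℕ) : ℤ) ≤ R := by exact_mod_cast h
    nlinarith
  refine ⟨?_, fun hne => ⟨fun hw hcase => ?_, fun hw hwR hnot => ?_⟩, fun hexc hw hwR => ?_,
    fun hwR => ?_⟩
  · rintro rfl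
    refine ⟨isSingleCyclic_of_progress hC hD (isLift_const hD 0) fun f g hf hg hfg hne => ?_,
      nonempty_relEmbedding_windGraph_zero hC hD⟩
    exact (exists_liftUp_or_locked hC hD hf hg hfg hne).resolve_right fun h => h.1.false
  · have hwR : w * r ≤ R := by
      rcases hcase with h | h
      · exact (hlt.1 h).le
      · exact (heq.1 h.1).le
    obtain ⟨f₀, hf₀⟩ := exists_isLift_of_le_greedy hC hD (hnonempty hwR)
    refine isSingleCyclic_of_progress hC hD hf₀ fun f g hf hg hfg hne => ?_
    refine (exists_liftUp_or_locked hC hD hf hg hfg hne).resolve_right fun h => ?_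
    have hb := h.2.1.greedy_eq hC hD hf
    generalize f 0 = b at hb
    rcases hcase with h' | ⟨-, h'⟩
    · -- A translate of `a` lies in `(b - s, b]`, and the walk from it already overtakes `b + n * w`.
      obtain ⟨j, t, hj, hjt⟩ := exists_residue hs (b - a)
      have h1 := greedy_mono_left C D (show (a : ℤ) + Y.length * t ≤ b by omega) m
      rw [greedy_add_mul hper, hb, ← hnw] at h1
      have h2 : ((w * r : ℕ) : ℤ) + 1 ≤ R := by exact_mod_cast hlt.1 h'
      nlinarith
    · obtain ⟨j, t, hj, rfl⟩ := exists_residue hs b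
      rw [greedy_add_mul hper] at hb
      have := h' j hj
      omega
  · push Not at hnot
    obtain ⟨b, -, hb⟩ := hnot
    obtain ⟨c, hc⟩ := exists_greedy_eq (by omega) hper C (hnonempty (heq.1 hwR).le) hb
    obtain ⟨p₀, hp₀, hl₀, -⟩ := exists_locked_of_greedy_eq hC hD hc
    exact ⟨card_windComponent_of_locked hC hD hDnc hw hne hp₀ hl₀ fun i => by omega,
      not_isCyclicComponent_of_locked hC hD hDnc hw hne hp₀ hl₀⟩
  · obtain ⟨f₀, hf₀⟩ := exists_isLift_of_le_greedy hC hD (hnonempty (hle.1 hwR))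
    refine isSingleCyclic_of_progress hC hD hf₀ fun f g hf hg hfg hne => ?_
    rcases exists_liftUp_or_locked hC hD hf hg hfg hne with h | ⟨-, hl, hfg'⟩
    · exact h
    · obtain ⟨h1, h2⟩ := hl.liftUp_of_exceptional hC hD hf hexc.1 hexc.2
      exact ⟨_, h1, h2, hfg'⟩
  · refine ⟨fun φ => hwR.not_ge (hle.2 (hmax ?_))⟩
    obtain ⟨f, hf, -⟩ := exists_isLift hC hD φ
    have h := hf.add_le_greedy hC hD
    obtain ⟨j, t, -, hjt⟩ := exists_residue hs (f 0)
    rw [hjt, greedy_add_mul hper, ← hnw] at h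
    exact ⟨j, by omega⟩
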